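/- \textbf{Setting.} Let $\mu\ge 0$ and $S=\mathbb{Z}[t_1^{\pm1},\dots,t_\mu^{\pm1}]$. A $\mu$-colored welded tangle diagram $(\tau,\psi)$ on $n$ strands is taken as a Gauss diagram: a compact oriented $1$-manifold made of circles and $n$ intervals whose boundary points are the marked points $x_1,\dots,x_{2n}$ of a circle, with finitely many signed classical crossings, each having an upper and a lower preimage, and with a map $\psi$ from the set of strands and circles to $\{t_1,\dots,t_\mu\}$ (virtual crossings carry no data and are ignored). Choose finitely many auxiliary points on the diagram and divide it into arcs at the lower preimages of the crossings and at the auxiliary points; enough auxiliary points are chosen for distinct marked points to lie on distinct arcs and for every arc to have a first point. If there are $p$ internal arcs (arcs not touching the boundary), there are $2n+p$ arcs, and $n+p$ crossings and auxiliary points. The matrix $M^\psi(\tau)$ has rows indexed by the crossings and auxiliary points and columns indexed by the arcs. At a crossing with upper arc $b$ of color $t_j$ and lower arcs $a$ (incoming), $c$ (outgoing) of color $t_i$, the row is $t_j\,a+(1-t_i)\,b-c$ if the crossing is positive and $-a+(1-t_i)\,b+t_j\,c$ if it is negative (contributions are added when arcs coincide); at an auxiliary point it is the incoming minus the outgoing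 arc. Let $H_\partial$ be the free $S$-module on $x_1,\dots,x_{2n}$ and $$\alpha(\tau,\psi)=\sum_{|I|=n}\bigl|M^\psi(\tau)_I\bigr|\,x_I\in\textstyle\bigwedge^nH_\partial ,$$ where $M^\psi(\tau)_I$ consists of the columns of the internal arcs followed by those of the arcs at $x_i$, $i\in I$, in increasing order. A $\mu$-colored circuit diagram $(P,\chi)$ with outer disk $D$ having $2n$ marked points and inner disks $D_1,\dots,D_p$ having $2n_1,\dots,2n_p$ marked points is a matching of all the marked points by oriented curves $c_1,\dots,c_q$, compatibly with prescribed signs of the marked points, together with a color in $\{t_1,\dots,t_\mu\}$ for each curve. Let $H_{\partial_i}$ and $H_\partial$ be the free $S$-modules on the marked points of $\partial D_i$ and $\partial D$, let $H$ be the free $S$-module on the curves, and let $m_i\colon H_{\partial_i}\to H$ and $m_\partial\colon H_\partial\to H$ send each marked point to the curve ending there. Let $\omega$ and $\omega_\partial$ be the volume forms of $H$ and $H_\partial$ related to these bases, and put $m=\bigwedge^{n_1}m_1\wedge\dots\wedge\bigwedge^{n_p}m_p$. The map $\gamma_{P,\chi}\colon\bigotimes_{i=1}^p\bigwedge^{n_i}H_{\partial_i}\to\bigwedge^nH_\partial$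 is the $S$-linear map such that $\omega(m(x)\wedge m_\partial(y))=\omega_\partial(\gamma_{P,\chi}(x)\wedge y)$ for all $x$ and all $y\in\bigwedge^nH_\partial$. \textbf{Proposition.} Let $(\tau,\psi)$ be the $\mu$-colored welded tangle diagram obtained by gluing $\mu$-colored welded tangle diagrams $(\tau_1,\psi_1),\dots,(\tau_p,\psi_p)$, with $n_1,\dots,n_p$ strands, into the inner disks of a $\mu$-colored circuit diagram $(P,\chi)$, where signs and colors agree at the marked points. Then there is exactly one map $\gamma_{P,\chi}$ as above, and for all choices of auxiliary points and of orderings of the rows in the definition of $\alpha$, $$\alpha(\tau,\psi)=\pm\,\gamma_{P,\chi}\bigl(\alpha(\tau_1,\psi_1)\otimes\cdots\otimes\alpha(\tau_p,\psi_p)\bigr)\in\textstyle\bigwedge^nH_\partial .$$ -/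

import Mathlib

open scoped TensorProduct

noncomputable section

/-- The Laurent polynomial ring `ℤ[t₁^{±1}, …, t_μ^{±1}]`, as the group ring of the free abelian
group of exponent vectors. -/
abbrev Laurent (μ : ℕ) : Type := AddMonoidAlgebra ℤ (Fin μ →₀ ℤ)

/-- The variable `t_i` of `Laurent μ`. -/
def Laurent.t {μ : ℕ} (i : Fin μ) : Laurent μ :=
  AddMonoidAlgebra.single (Finsupp.single i 1) 1

/-- The module `H_∂` freely generated by `2n` marked points `x_1, …, x_{2n}` of a circle. -/
abbrev BoundaryModule (μ n : ℕ) : Type := Fin (2 * n) → Laurent μ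

/-- The distinguished points in the interior of a tangle diagram: the upper and the lower preimage
of a classical crossing, and auxiliary points that interrupt the diagram. -/
inductive Site (C P : Type) : Type
  | upper (c : C) : Site C P
  | lower (c : C) : Site C P
  | point (p : P) : Site C P

namespace Site

/-- Relabelling of crossings and points. -/
def map {C P C' P' : Type} (f : C → C') (g : P → P') : Site C P → Site C' P'
  | upper c => upper (f c)
  | lower c => lower (f c)
  | point p => point (g p)

end Site

/-- A `μ`-colored welded tangle diagram on `n` strands, as a Gauss diagram: virtual crossings are
not recorded.

The diagram is an oriented compact 1-manifold with `2n` boundary points `x_j`, `j : Fin (2 * n)`,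
where `inward j = true` if the strand ending at `x_j` starts there (it runs into the disk), and
`inward j = false` if it terminates there. The 1-manifold is cut into oriented edges by the
preimages of the classical crossings and by finitely many auxiliary points. Every edge starts at
(`tail`) an inward marked point or at an interior site, and terminates at (`head`) an outward marked
point or at an interior site; every such place is the start, resp. the end, of exactly one edge.
A circle carries at least one site. The coloring takes equal values on consecutive edges, so that it
is a function on the set of strands and circles. -/
structure WeldedTangle (μ : ℕ) {n : ℕ} (inward : Fin (2 * n) → Bool) where
  /-- the classical crossings -/
  Crossing : Type
  /-- the auxiliary points -/
  Point : Type
  /-- the edges -/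
  Edge : Type
  finite_crossing : Finite Crossing
  finite_point : Finite Point
  /-- whether a classical crossing is positive or negative -/
  positive : Crossing → Bool
  /-- where an edge starts -/
  tail : Edge ≃ {j // inward j = true} ⊕ Site Crossing Point
  /-- where an edge terminates -/
  head : Edge ≃ {j // inward j = false} ⊕ Site Crossing Point
  /-- the color of an edge -/
  color : Edge → Fin μ
  color_eq : ∀ s, color (head.symm (Sum.inr s)) = color (tail.symm (Sum.inr s))

namespace WeldedTangle

variable {μ n : ℕ} {inward : Fin (2 * n) → Bool}

/-- The edge terminating at an interior site. -/
def inEdge (T : WeldedTangle μ inward) (s : Site T.Crossing T.Point) : T.Edge :=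
  T.head.symm (Sum.inr s)

/-- The edge starting at an interior site. -/
def outEdge (T : WeldedTangle μ inward) (s : Site T.Crossing T.Point) : T.Edge :=
  T.tail.symm (Sum.inr s)

/-- The edge that ends at the marked point `x_j`. -/
def boundaryEdge (T : WeldedTangle μ inward) (j : Fin (2 * n)) : T.Edge :=
  if h : inward j = true then T.tail.symm (Sum.inl ⟨j, h⟩)
  else T.head.symm (Sum.inl ⟨j, by simpa using h⟩)

/-- The arcs of the diagram: maximal unions of consecutive edges that are joined at upper preimages
of crossings. They are interrupted at the lower preimages and at the auxiliary points. -/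
def Arc (T : WeldedTangle μ inward) : Type :=
  Quot fun e f : T.Edge => ∃ c, e = T.inEdge (Site.upper c) ∧ f = T.outEdge (Site.upper c)

/-- The arc that contains a given edge. -/
def arc (T : WeldedTangle μ inward) (e : T.Edge) : T.Arc := Quot.mk _ e

/-- The arc at the marked point `x_j`. -/
def boundaryArc (T : WeldedTangle μ inward) (j : Fin (2 * n)) : T.Arc := T.arc (T.boundaryEdge j)

/-- The arcs that do not touch the boundary circle. -/
def InternalArc (T : WeldedTangle μ inward) : Type := {a : T.Arc // a ∉ Set.range T.boundaryArc}

/-- The indices of the rows of the matrix: classical crossings and interrupting points. -/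
abbrev Row (T : WeldedTangle μ inward) : Type := T.Crossing ⊕ T.Point

/-- The diagram has enough interrupting points: distinct marked points lie on distinct arcs, and
every arc has a first edge, which starts at the boundary, at the lower preimage of a crossing, or at
an auxiliary point. -/
def IsInterrupted (T : WeldedTangle μ inward) : Prop :=
  Function.Injective T.boundaryArc ∧
    ∀ a : T.Arc, ∃ e, T.arc e = a ∧ ∀ c, T.tail e ≠ Sum.inr (Site.upper c)

/-- The matrix `M^ψ(τ)`. At a crossing with upper arc `b` of color `t_j`, incoming lower arc `a` and
outgoing lower arc `c` of color `t_i`, the row is `t_j a + (1 - t_i) b - c` if the crossing is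
positive, and `-a + (1 - t_i) b + t_j c` if it is negative (contributions are added if arcs
coincide). At an interrupting point, the row is the incoming arc minus the outgoing arc. -/
def matrix (T : WeldedTangle μ inward) : Matrix T.Row T.Arc (Laurent μ) := by
  classical
  exact Matrix.of fun r => match r with
    | Sum.inl c =>
        let a := T.inEdge (Site.lower c)
        let b := T.inEdge (Site.upper c)
        let d := T.outEdge (Site.lower c)
        let ti := Laurent.t (T.color a)
        let tj := Laurent.t (T.color b)
        if T.positive c = true then
          Pi.single (T.arc a) tj + Pi.single (T.arc b) (1 - ti) + Pi.single (T.arc d) (-1)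
        else
          Pi.single (T.arc a) (-1) + Pi.single (T.arc b) (1 - ti) + Pi.single (T.arc d) tj
    | Sum.inr p =>
        Pi.single (T.arc (T.inEdge (Site.point p))) 1 +
          Pi.single (T.arc (T.outEdge (Site.point p))) (-1)

/-- An ordering of the rows of the matrix, by means of the internal arcs and `n` further indices.
The matrix has `p + n` rows, where `p` is the number of internal arcs. -/
abbrev RowOrder (T : WeldedTangle μ inward) : Type := T.InternalArc ⊕ Fin n ≃ T.Row

/-- The arcs of an interrupted diagram correspond to their starting places. -/
theorem card_arc (T : WeldedTangle μ inward) (hT : T.IsInterrupted) :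
    Nat.card T.Arc = Nat.card ({j // inward j = true} ⊕ T.Row) := by
  classical
  let r : T.Edge → T.Edge → Prop :=
    fun e f => ∃ c, e = T.inEdge (Site.upper c) ∧ f = T.outEdge (Site.upper c)
  have hr : Relator.RightUnique r := by
    rintro e f g ⟨c, h1, rfl⟩ ⟨c', h2, rfl⟩
    have h3 := h1.symm.trans h2
    simp only [inEdge, EmbeddingLike.apply_eq_iff_eq, Sum.inr.injEq, Site.upper.injEq] at h3
    rw [h3]
  have hr' : Relator.RightUnique (Function.swap r) := by
    rintro e f g ⟨c, rfl, h1⟩ ⟨c', rfl, h2⟩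
    have h3 := h1.symm.trans h2
    simp only [outEdge, EmbeddingLike.apply_eq_iff_eq, Sum.inr.injEq, Site.upper.injEq] at h3
    rw [h3]
  have key : ∀ e f, Relation.EqvGen r e f →
      Relation.ReflTransGen r e f ∨ Relation.ReflTransGen r f e := by
    intro e f h
    induction h with
    | rel _ _ h => exact Or.inl (Relation.ReflTransGen.single h)
    | refl _ => exact Or.inl Relation.ReflTransGen.refl
    | symm _ _ _ ih => exact ih.symm
    | trans e f g _ _ ih1 ih2 =>
      rcases ih1 with h1 | h1 <;> rcases ih2 with h2 | h2
      · exact Or.inl (h1.trans h2)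
      · have := Relation.ReflTransGen.total_of_right_unique hr'
          (Relation.reflTransGen_swap.2 h1) (Relation.reflTransGen_swap.2 h2)
        exact (this.imp Relation.reflTransGen_swap.1 Relation.reflTransGen_swap.1).symm
      · exact Relation.ReflTransGen.total_of_right_unique hr h1 h2
      · exact Or.inr (h2.trans h1)
  let st : {j // inward j = true} ⊕ T.Row → {j // inward j = true} ⊕ Site T.Crossing T.Point :=
    Sum.map id (Sum.elim Site.lower Site.point)
  have st_inj : Function.Injective st := by
    rintro (j | (c | a)) (j' | (c' | a')) h <;> simp_all [st]
  have st_ne : ∀ x c, st x ≠ Sum.inr (Site.upper c) := by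
    rintro (j | (c | a)) c' <;> simp [st]
  have start : ∀ x f, Relation.ReflTransGen r f (T.tail.symm (st x)) → f = T.tail.symm (st x) := by
    intro x f h
    rcases Relation.ReflTransGen.cases_tail h with h | ⟨g, _, c, _, h⟩
    · exact h.symm
    · exact absurd (T.tail.symm.injective h) (st_ne x c)
  refine (Nat.card_eq_of_bijective (fun x => T.arc (T.tail.symm (st x))) ⟨?_, ?_⟩).symm
  · intro x y h
    rcases key _ _ (Quot.eqvGen_exact h) with h | h
    · exact st_inj (T.tail.symm.injective (start y _ h))
    · exact st_inj (T.tail.symm.injective (start x _ h)).symm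
  · intro a
    obtain ⟨e, rfl, h⟩ := hT.2 a
    obtain ⟨y, rfl⟩ := T.tail.symm.surjective e
    rcases y with j | (c | c | a)
    · exact ⟨Sum.inl j, rfl⟩
    · exact absurd (by simp) (h c)
    · exact ⟨Sum.inr (Sum.inl c), rfl⟩
    · exact ⟨Sum.inr (Sum.inr a), rfl⟩

/-- The matrix of an interrupted diagram has size `(p + n) × (p + 2n)`, so that the minors in the
definition of `alpha` make sense. -/
theorem nonempty_rowOrder (T : WeldedTangle μ inward) (hT : T.IsInterrupted) :
    Nonempty T.RowOrder := by
  classical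
  have := T.finite_crossing
  have := T.finite_point
  have hsite : Finite (Site T.Crossing T.Point) :=
    Finite.of_surjective (Sum.elim Site.upper (Sum.elim Site.lower Site.point) :
      T.Crossing ⊕ T.Crossing ⊕ T.Point → Site T.Crossing T.Point) (by
        rintro (c | c | a)
        · exact ⟨Sum.inl c, rfl⟩
        · exact ⟨Sum.inr (Sum.inl c), rfl⟩
        · exact ⟨Sum.inr (Sum.inr a), rfl⟩)
  have hedge : Finite T.Edge := Finite.of_equiv _ T.tail.symm
  have harc : Finite T.Arc := inferInstanceAs (Finite (Quot _))
  have hint : Finite T.InternalArc := inferInstanceAs (Finite {a : T.Arc // _})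
  have h1 := Nat.card_congr (T.tail.symm.trans T.head)
  rw [Nat.card_sum, Nat.card_sum] at h1
  have h2 : Nat.card {j // inward j = true} + Nat.card {j // inward j = false} = 2 * n := by
    rw [← Nat.card_sum]
    have e : {j // inward j = false} ≃ {j // ¬ inward j = true} :=
      Equiv.subtypeEquivRight (by simp)
    rw [Nat.card_congr ((Equiv.sumCongr (Equiv.refl _) e).trans
      (Equiv.sumCompl fun j => inward j = true))]
    simp
  have h3 : Nat.card T.InternalArc + 2 * n = Nat.card T.Arc := by
    have e := Equiv.sumCompl fun a => a ∈ Set.range T.boundaryArc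
    rw [← Nat.card_congr e, Nat.card_sum, add_comm]
    congr 1
    exact (Nat.card_fin (2 * n)).symm.trans (Nat.card_congr (Equiv.ofInjective _ hT.1))
  have h4 := T.card_arc hT
  rw [Nat.card_sum] at h4
  have h5 : Nat.card (T.InternalArc ⊕ Fin n) = Nat.card T.Row := by
    rw [Nat.card_sum, Nat.card_fin]
    omega
  exact ⟨(Finite.equivFin _).trans ((finCongr h5).trans (Finite.equivFin _).symm)⟩

/-- The minor `|M^ψ(τ)_I|` on the columns of the internal arcs followed by the columns of the
arcs at the marked points `x_i`, `i ∈ I`, in increasing order. -/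
def minor (T : WeldedTangle μ inward) (ρ : T.RowOrder)
    (I : Set.powersetCard (Fin (2 * n)) n) : Laurent μ := by
  classical
  have : Finite (T.InternalArc ⊕ Fin n) := by
    have := T.finite_crossing
    have := T.finite_point
    exact Finite.of_equiv _ ρ.symm
  letI : Fintype (T.InternalArc ⊕ Fin n) := Fintype.ofFinite _
  exact (T.matrix.submatrix ρ (Sum.elim (fun a : T.InternalArc => a.1)
    fun l => T.boundaryArc (Set.powersetCard.ofFinEmbEquiv.symm I l))).det

/-- The invariant `α(τ, ψ) = ∑_I |M^ψ(τ)_I| x_I` in `⋀^n H_∂`. Its sign depends on the ordering of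
the rows. -/
def alpha (T : WeldedTangle μ inward) (ρ : T.RowOrder) :
    ⋀[Laurent μ]^n (BoundaryModule μ n) :=
  ∑ I : Set.powersetCard (Fin (2 * n)) n, T.minor ρ I •
    exteriorPower.ιMulti_family (Laurent μ) n (Pi.basisFun (Laurent μ) (Fin (2 * n))) I

/-- Isomorphism (relabelling) of diagrams with auxiliary points. -/
def Iso (T T' : WeldedTangle μ inward) : Prop :=
  ∃ (f : T.Crossing ≃ T'.Crossing) (g : T.Point ≃ T'.Point) (h : T.Edge ≃ T'.Edge),
    (∀ c, T'.positive (f c) = T.positive c) ∧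
    (∀ e, T'.tail (h e) = Sum.map id (Site.map f g) (T.tail e)) ∧
    (∀ e, T'.head (h e) = Sum.map id (Site.map f g) (T.head e)) ∧
    (∀ e, T'.color (h e) = T.color e)

end WeldedTangle

/-- Adding one edge `none`, incident with one new point. -/
def addEdge {A E C P : Type} (φ : E ≃ A ⊕ Site C P) : Option E ≃ A ⊕ Site C (Option P) where
  toFun
    | none => Sum.inr (Site.point none)
    | some e => Sum.map id (Site.map id some) (φ e)
  invFun
    | Sum.inl a => some (φ.symm (Sum.inl a))
    | Sum.inr (Site.upper c) => some (φ.symm (Sum.inr (Site.upper c)))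
    | Sum.inr (Site.lower c) => some (φ.symm (Sum.inr (Site.lower c)))
    | Sum.inr (Site.point none) => none
    | Sum.inr (Site.point (some p)) => some (φ.symm (Sum.inr (Site.point p)))
  left_inv e := by
    rcases e with _ | e
    · rfl
    · obtain ⟨y, rfl⟩ := φ.symm.surjective e
      rcases y with a | (c | c | p) <;> simp [Site.map]
  right_inv y := by
    rcases y with a | (c | c | (_ | p)) <;> simp [Site.map]

namespace WeldedTangle

variable {μ n : ℕ} {inward : Fin (2 * n) → Bool}

/-- The diagram with one more auxiliary point, placed on the edge `e₀`: the first half of the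
subdivided edge is `some e₀`, the second half is `none`. -/
def insertPoint (T : WeldedTangle μ inward) (e₀ : T.Edge) : WeldedTangle μ inward := by
  classical
  exact
  { Crossing := T.Crossing
    Point := Option T.Point
    Edge := Option T.Edge
    finite_crossing := T.finite_crossing
    finite_point := have := T.finite_point; inferInstance
    positive := T.positive
    tail := addEdge T.tail
    head := (Equiv.swap none (some e₀)).trans (addEdge T.head)
    color := fun e => T.color (e.getD e₀)
    color_eq := by
      have key : ∀ y : Option T.Edge,
          T.color ((Equiv.swap none (some e₀) y).getD e₀) = T.color (y.getD e₀) := by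
        intro y
        rcases y with _ | e
        · simp
        · by_cases h : e = e₀
          · subst h; simp
          · rw [Equiv.swap_apply_of_ne_of_ne (by simp) (by simpa using h)]
      intro s
      simp only [Equiv.symm_trans_apply, Equiv.symm_swap, key]
      rcases s with c | c | (_ | p)
      · exact T.color_eq (Site.upper c)
      · exact T.color_eq (Site.lower c)
      · rfl
      · exact T.color_eq (Site.point p) }

/-- `Subdivision T T'`: up to relabelling, `T'` is obtained from `T` by adding finitely many
auxiliary points. -/
inductive Subdivision : WeldedTangle μ inward → WeldedTangle μ inward → Prop
  | iso {T T' : WeldedTangle μ inward} : T.Iso T' → Subdivision T T'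
  | insert {T T' T'' : WeldedTangle μ inward} (e : T'.Edge) :
      Subdivision T T' → (T'.insertPoint e).Iso T'' → Subdivision T T''

/-- Two diagrams differ only by their labels and their auxiliary points, that is, they are the same
colored welded tangle diagram once auxiliary points are disregarded. -/
def SameTangle (T T' : WeldedTangle μ inward) : Prop :=
  ∃ T'', Subdivision T T'' ∧ Subdivision T' T''

end WeldedTangle

/-- A `μ`-colored circuit `p`-diagram. The outer disk has `2n` and the inner disk `D_i` has `2 (k i)`
marked points; `inward j` tells whether a tangle in the outer disk runs into that disk at `x_j`, and
`inner i x` tells the same for a tangle in `D_i`. The oriented curves `c_1, …, c_q` therefore start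
at inward points of the outer disk and at outward points of the inner disks, and they terminate at
outward points of the outer disk and at inward points of the inner disks; every marked point is
an end of exactly one curve. Only this matching is recorded. -/
structure CircuitDiagram (μ : ℕ) {n p : ℕ} {k : Fin p → ℕ}
    (inward : Fin (2 * n) → Bool) (inner : ∀ i, Fin (2 * k i) → Bool) where
  /-- the number of curves -/
  q : ℕ
  /-- the starting point of a curve -/
  tail : Fin q ≃ {j // inward j = true} ⊕ (Σ i, {x // inner i x = false})
  /-- the terminal point of a curve -/
  head : Fin q ≃ {j // inward j = false} ⊕ (Σ i, {x // inner i x = true})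
  /-- the color of a curve -/
  color : Fin q → Fin μ

namespace CircuitDiagram

variable {μ n p : ℕ} {k : Fin p → ℕ} {inward : Fin (2 * n) → Bool}
  {inner : ∀ i, Fin (2 * k i) → Bool}

/-- The curve ending at a marked point of the outer disk. -/
def outerCurve (D : CircuitDiagram μ inward inner) (j : Fin (2 * n)) : Fin D.q :=
  if h : inward j = true then D.tail.symm (Sum.inl ⟨j, h⟩)
  else D.head.symm (Sum.inl ⟨j, by simpa using h⟩)

/-- The curve ending at a marked point of the inner disk `D_i`. -/
def innerCurve (D : CircuitDiagram μ inward inner) (i : Fin p) (x : Fin (2 * k i)) : Fin D.q :=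
  if h : inner i x = true then D.head.symm (Sum.inr ⟨i, x, h⟩)
  else D.tail.symm (Sum.inr ⟨i, x, by simpa using h⟩)

/-- The free module `H` generated by the curves. -/
abbrev CurveModule (D : CircuitDiagram μ inward inner) : Type := Fin D.q → Laurent μ

/-- The map `m_∂ : H_∂ → H` sending a marked point to the curve ending there. -/
def outerMap (D : CircuitDiagram μ inward inner) :
    BoundaryModule μ n →ₗ[Laurent μ] D.CurveModule :=
  (Pi.basisFun (Laurent μ) (Fin (2 * n))).constr (Laurent μ)
    fun j => Pi.single (D.outerCurve j) 1

/-- The map `m_i : H_{∂_i} → H` sending a marked point to the curve ending there. -/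
def innerMap (D : CircuitDiagram μ inward inner) (i : Fin p) :
    BoundaryModule μ (k i) →ₗ[Laurent μ] D.CurveModule :=
  (Pi.basisFun (Laurent μ) (Fin (2 * k i))).constr (Laurent μ)
    fun x => Pi.single (D.innerCurve i x) 1

end CircuitDiagram

/-- The volume form `⋀^q S^q → S` related to the standard basis, extended by zero to the other
degrees of the exterior algebra. -/
def volumeForm (μ q : ℕ) :
    ExteriorAlgebra (Laurent μ) (Fin q → Laurent μ) →ₗ[Laurent μ] Laurent μ :=
  ExteriorAlgebra.liftAlternating
    (Pi.single q (Matrix.detRowAlternating : (Fin q → Laurent μ) [⋀^Fin q]→ₗ[Laurent μ] Laurent μ))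

namespace CircuitDiagram

variable {μ n p : ℕ} {k : Fin p → ℕ} {inward : Fin (2 * n) → Bool}
  {inner : ∀ i, Fin (2 * k i) → Bool}

/-- The tensor product `⨂_i ⋀^{n_i} H_{∂_i}`. -/
abbrev Source (μ : ℕ) {p : ℕ} (k : Fin p → ℕ) : Type :=
  ⨂[Laurent μ] i, ⋀[Laurent μ]^(k i) (BoundaryModule μ (k i))

/-- The map `m`, sending `u_1 ⊗ ⋯ ⊗ u_p` to
`(⋀^{n_1} m_1)(u_1) ∧ ⋯ ∧ (⋀^{n_p} m_p)(u_p)`. -/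
def innerWedge (D : CircuitDiagram μ inward inner) :
    Source μ k →ₗ[Laurent μ] ExteriorAlgebra (Laurent μ) D.CurveModule :=
  PiTensorProduct.lift
    ((MultilinearMap.mkPiAlgebraFin (Laurent μ) p
      (ExteriorAlgebra (Laurent μ) D.CurveModule)).compLinearMap
      fun i => (ExteriorAlgebra.map (D.innerMap i)).toLinearMap ∘ₗ
        (⋀[Laurent μ]^(k i) (BoundaryModule μ (k i))).subtype)

/-- The property that defines `γ_{P,χ} : ⨂_i ⋀^{n_i} H_{∂_i} → ⋀^n H_∂`: for all `x` and `y`,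
`ω (m x ∧ m_∂ y) = ω_∂ (γ x ∧ y)`. -/
def IsGamma (D : CircuitDiagram μ inward inner)
    (γ : Source μ k →ₗ[Laurent μ] ⋀[Laurent μ]^n (BoundaryModule μ n)) : Prop :=
  ∀ (x : Source μ k) (y : ⋀[Laurent μ]^n (BoundaryModule μ n)),
    volumeForm μ D.q (D.innerWedge x * ExteriorAlgebra.map D.outerMap y.1) =
      volumeForm μ (2 * n) ((γ x).1 * y.1)

/-- The colors of the tangles agree with the colors of the circuit diagram at the marked points. -/
def ColorsMatch (D : CircuitDiagram μ inward inner) (T : ∀ i, WeldedTangle μ (inner i)) : Prop :=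
  ∀ i x, (T i).color ((T i).boundaryEdge x) = D.color (D.innerCurve i x)

/-- The auxiliary points of the glued diagram: those of the tangles, and the marked points of the
inner disks. -/
abbrev GluePoint (T : ∀ i, WeldedTangle μ (inner i)) : Type :=
  (Σ i, (T i).Point) ⊕ (Σ i, Fin (2 * k i))

/-- The sites of the tangle in `D_i`, as sites of the glued diagram. -/
def glueSite (T : ∀ i, WeldedTangle μ (inner i)) (i : Fin p)
    (s : Site (T i).Crossing (T i).Point) : Site (Σ i, (T i).Crossing) (GluePoint T) :=
  s.map (Sigma.mk i) fun a => Sum.inl ⟨i, a⟩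

/-- The marked points of the inner disks, as auxiliary points of the glued diagram. -/
def glueMarked (T : ∀ i, WeldedTangle μ (inner i)) (i : Fin p) (x : Fin (2 * k i)) :
    Site (Σ i, (T i).Crossing) (GluePoint T) :=
  Site.point (Sum.inr ⟨i, x⟩)

/-- The incidence of the glued diagram, for starting points (`b = true`) and for terminal points
(`b = false`): the edges are the edges of the tangles and the curves of the circuit diagram. -/
def glueEnds (T : ∀ i, WeldedTangle μ (inner i)) (b : Bool) {q : ℕ}
    (ends : ∀ i, (T i).Edge ≃ {x // inner i x = b} ⊕ Site (T i).Crossing (T i).Point)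
    (curve : Fin q ≃ {j // inward j = b} ⊕ (Σ i, {x // inner i x = !b})) :
    (Σ i, (T i).Edge) ⊕ Fin q ≃
      {j // inward j = b} ⊕ Site (Σ i, (T i).Crossing) (GluePoint T) where
  toFun
    | Sum.inl ⟨i, e⟩ =>
        Sum.inr (Sum.elim (fun x => glueMarked T i x.1) (glueSite T i) (ends i e))
    | Sum.inr c => Sum.map id (fun x => glueMarked T x.1 x.2.1) (curve c)
  invFun
    | Sum.inl j => Sum.inr (curve.symm (Sum.inl j))
    | Sum.inr (Site.upper c) => Sum.inl ⟨c.1, (ends c.1).symm (Sum.inr (Site.upper c.2))⟩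
    | Sum.inr (Site.lower c) => Sum.inl ⟨c.1, (ends c.1).symm (Sum.inr (Site.lower c.2))⟩
    | Sum.inr (Site.point (Sum.inl a)) =>
        Sum.inl ⟨a.1, (ends a.1).symm (Sum.inr (Site.point a.2))⟩
    | Sum.inr (Site.point (Sum.inr x)) =>
        if h : inner x.1 x.2 = b then Sum.inl ⟨x.1, (ends x.1).symm (Sum.inl ⟨x.2, h⟩)⟩
        else Sum.inr (curve.symm (Sum.inr ⟨x.1, x.2, Bool.eq_not_of_ne h⟩))
  left_inv e := by
    rcases e with ⟨i, e⟩ | c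
    · obtain ⟨y, rfl⟩ := (ends i).symm.surjective e
      rcases y with ⟨x, h⟩ | (c | c | a)
      · simp [glueMarked, h]
      all_goals simp [glueSite, Site.map]
    · obtain ⟨y, rfl⟩ := curve.symm.surjective c
      rcases y with j | ⟨i, x, h⟩
      · simp
      · simp [glueMarked, h]
  right_inv y := by
    rcases y with j | (c | c | (a | ⟨i, x⟩))
    · simp
    · simp [glueSite, Site.map]
    · simp [glueSite, Site.map]
    · simp [glueSite, Site.map]
    · by_cases h : inner i x = b
      · simp [glueMarked, h]
      · simp [glueMarked, h]

/-- The colored welded tangle diagram obtained by gluing `T_i` into the inner disk `D_i` of the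
circuit diagram, for all `i`. -/
def glue (D : CircuitDiagram μ inward inner) (T : ∀ i, WeldedTangle μ (inner i))
    (hT : D.ColorsMatch T) : WeldedTangle μ inward where
  Crossing := Σ i, (T i).Crossing
  Point := GluePoint T
  Edge := (Σ i, (T i).Edge) ⊕ Fin D.q
  finite_crossing := by
    have := fun i => (T i).finite_crossing
    infer_instance
  finite_point := by
    have := fun i => (T i).finite_point
    infer_instance
  positive := fun c => (T c.1).positive c.2
  tail := glueEnds T true (fun i => (T i).tail) D.tail
  head := glueEnds T false (fun i => (T i).head) D.head
  color := Sum.elim (fun e => (T e.1).color e.2) D.color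
  color_eq := by
    intro s
    rcases s with ⟨i, c⟩ | ⟨i, c⟩ | (⟨i, a⟩ | ⟨i, x⟩)
    · exact (T i).color_eq (Site.upper c)
    · exact (T i).color_eq (Site.lower c)
    · exact (T i).color_eq (Site.point a)
    · have h := hT i x
      by_cases hx : inner i x = true
      · simp only [WeldedTangle.boundaryEdge, innerCurve, hx, dif_pos] at h
        simp [glueEnds, hx, h]
      · rw [Bool.not_eq_true] at hx
        simp only [WeldedTangle.boundaryEdge, innerCurve, hx] at h
        simpa [glueEnds, hx] using h

end CircuitDiagram

end

/-!
Write `ω_∂` for the volume form of `H_∂`. The pairing `(u, y) ↦ ω_∂ (u ∧ y)` on `⋀^n H_∂` is perfect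
(`wedgePairing_bijective`): it sends the basis vector `x_I` to plus or minus the coordinate of the
complement of `I`. This gives existence and uniqueness of `γ`, and it remains to compare, up to a
common sign, the alternating forms `y ↦ ω_∂ (α(τ) ∧ y)` and `y ↦ ω (m (⊗ α(τ_i)) ∧ m_∂ y)`.

To every diagram, interrupted or not, belongs an alternating form `edgeForm` on `H_∂`. The
generators are the edges instead of the arcs, every interior site gives a relation between edges (at
an upper preimage, the incoming minus the outgoing edge), and `edgeForm` is the determinant of these
relations together with the images of `n` vectors `y l` of `H_∂`. The tool is the elimination of
generators (`exists_rowDet_elim`): when some of the relations identify generators with each other,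
these relations and the superfluous generators may be removed, and the determinant changes by a unit.
This unit is `± 1`, since the identifications hold over `ℤ`.

* An auxiliary point can be eliminated. So, up to sign, `edgeForm` does not depend on the auxiliary
  points (`Subdivision.exists_edgeForm`), even where the diagrams in between are not interrupted and
  have no invariant `α`. This matters, since a glued diagram need not be interrupted: a curve may
  join two marked points of the outer disk.
* In a glued diagram, eliminate the relations of the upper preimages and of the inner marked points.
  The internal arcs of the `τ_i` and the curves remain, and the rows that belong to `τ_i` are those
  of its matrix, with the arcs at marked points replaced by curves. Laplace expansion along these
  blocks of rows (`rowDet_laplace`) produces the products of minors of the `τ_i`, that is, the form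
  `ω (m (⊗ α(τ_i)) ∧ m_∂ y)` (`exists_edgeForm_glue`).
* Gluing an interrupted diagram `τ` into the trivial circuit diagram, where `m` and `m_∂` are
  identities, only adds auxiliary points. Therefore `edgeForm` of `τ` is `± ω_∂ (α(τ) ∧ y)`
  (`exists_edgeForm_eq_wedgePairing`).
-/

noncomputable section

/-! ### Determinants up to sign, and elimination of generators -/

section RowDet

variable {R : Type*} [CommRing R]

/-- The determinant of a square matrix given by its rows `v i : E → R`, where the rows are indexed
by a type that is identified with the type of columns by `e`. Another choice of `e` changes it by a
sign that does not depend on the matrix. -/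
def rowDet {I E : Type*} [Finite E] (e : I ≃ E) : (E → R) [⋀^I]→ₗ[R] R := by
  classical
  letI := Fintype.ofFinite E
  exact Matrix.detRowAlternating.domDomCongr e.symm

lemma rowDet_apply {I E : Type*} [hF : Fintype E] [hD : DecidableEq E] (e : I ≃ E) (v : I → E → R) :
    rowDet e v = (Matrix.of fun x => v (e.symm x)).det := by
  rw [Subsingleton.elim hF (Fintype.ofFinite E),
    Subsingleton.elim hD fun a b => Classical.propDecidable (a = b)]
  rfl

lemma rowDet_eq_sign_smul {I E : Type*} [Finite E] (e e' : I ≃ E) :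
    ∃ ε : ℤˣ, ∀ v : I → E → R, rowDet e v = ε • rowDet e' v := by
  classical
  have := Fintype.ofFinite E
  refine ⟨Equiv.Perm.sign (e.symm.trans e'), fun v => ?_⟩
  rw [rowDet_apply, rowDet_apply]
  have := Matrix.det_permute (e.symm.trans e') (Matrix.of fun x => v (e'.symm x))
  rw [Units.smul_def, zsmul_eq_mul, ← this]
  congr 1
  ext x y
  simp

lemma rowDet_reindex {I J E : Type*} [Finite E] (e : I ≃ E) (σ : J ≃ I) (v : I → E → R) :
    rowDet (σ.trans e) (fun j => v (σ j)) = rowDet e v := by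
  classical
  have := Fintype.ofFinite E
  rw [rowDet_apply, rowDet_apply]
  congr 1
  ext x y
  simp

/-- The case of `exists_rowDet_elim` in which the rows are indexed by the disjoint union itself. -/
lemma exists_rowDet_sumElim {C B E A : Type*} [Finite E] [DecidableEq E] [Finite A]
    (c : C → E → ℤ) (s : A → E) (π : E → A)
    (h : ∀ e, Pi.single e 1 - Pi.single (s (π e)) 1 ∈ Submodule.span ℤ (Set.range c))
    (e₁ : C ⊕ B ≃ E) (e₂ : B ≃ A) :
    ∃ ε : ℤˣ, ∀ f : B → E → R,
      rowDet e₁ (Sum.elim (fun i x => (c i x : R)) f) =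
        ε • rowDet e₂ fun b => FunOnFinite.linearMap R R π (f b) := by
  classical
  have := Fintype.ofFinite E
  have := Fintype.ofFinite A
  have : Finite (C ⊕ B) := Finite.of_equiv _ e₁.symm
  have : Finite C := Finite.of_injective (Sum.inl : C → C ⊕ B) Sum.inl_injective
  have : Finite B := Finite.of_injective (Sum.inr : B → C ⊕ B) Sum.inr_injective
  have := Fintype.ofFinite C
  have := Fintype.ofFinite B
  choose x hx using fun e => (Submodule.mem_span_range_iff_exists_fun ℤ).1 (h e)
  -- The relations `c` and the generators `s a` form a basis of `ℤ^E`: `N` has the inverse `L`.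
  let N : Matrix E E ℤ := Matrix.of fun y =>
    Sum.elim c (fun b z => if z = s (e₂ b) then 1 else 0) (e₁.symm y)
  let L : Matrix E E ℤ := Matrix.of fun e y =>
    Sum.elim (x e) (fun b => if e₂ b = π e then 1 else 0) (e₁.symm y)
  have hLN : L * N = 1 := by
    ext e z
    rw [Matrix.mul_apply]
    simp only [L, N, Matrix.of_apply]
    rw [e₁.symm.sum_comp (fun y => Sum.elim (x e) (fun b => if e₂ b = π e then 1 else 0) y *
      Sum.elim c (fun b z => if z = s (e₂ b) then (1 : ℤ) else 0) y z), Fintype.sum_sum_type]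
    simp only [Sum.elim_inl, Sum.elim_inr, ite_mul, one_mul, zero_mul]
    rw [e₂.sum_comp (fun a => if a = π e then (if z = s a then (1 : ℤ) else 0) else 0)]
    have h1 := congrFun (hx e) z
    simp only [Finset.sum_apply, Pi.smul_apply, smul_eq_mul, Pi.sub_apply, Pi.single_apply] at h1
    simp [Matrix.one_apply, eq_comm (a := e), h1]
  have hN : IsUnit N.det := by
    refine IsUnit.of_mul_eq_one L.det ?_
    rw [mul_comm, ← Matrix.det_mul, hLN, Matrix.det_one]
  obtain ⟨ε, hε⟩ := hN
  refine ⟨ε, fun f => ?_⟩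
  let NR : Matrix E E R := N.map (Int.castRingHom R)
  let LR : Matrix E E R := L.map (Int.castRingHom R)
  have hLNR : LR * NR = 1 := by
    rw [← Matrix.map_mul, hLN]
    simp
  have hdet : NR.det = ((ε : ℤ) : R) := by
    rw [hε]
    exact ((Int.castRingHom R).map_det N).symm
  -- `K` holds the coordinates of all relations with respect to the basis `N`. Its last block consists
  -- of the coordinates of `f` at the generators `s a`, which are the rows `π (f b)`.
  let K : Matrix (C ⊕ B) (C ⊕ B) R := Matrix.fromBlocks 1 0
    (Matrix.of fun b i => (Matrix.vecMul (f b) LR) (e₁ (Sum.inl i)))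
    (Matrix.of fun b b' => (Matrix.vecMul (f b) LR) (e₁ (Sum.inr b')))
  have hF : (Matrix.of fun y => Sum.elim (fun i x => (c i x : R)) f (e₁.symm y)) =
      K.submatrix e₁.symm e₁.symm * NR := by
    ext y z
    obtain ⟨y, rfl⟩ := e₁.surjective y
    rcases y with i | b
    · simp only [Matrix.of_apply, Equiv.symm_apply_apply, Sum.elim_inl, Matrix.mul_apply,
        Matrix.submatrix_apply]
      rw [Finset.sum_eq_single (e₁ (Sum.inl i))]
      · simp [K, NR, N]
      · intro y _ hy
        obtain ⟨y, rfl⟩ := e₁.surjective y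
        rcases y with j | b
        · have : i ≠ j := by rintro rfl; exact hy rfl
          simp [K, Matrix.one_apply_ne this]
        · simp [K]
      · simp
    · have h1 : (Matrix.vecMul (f b) LR) = fun y => K (Sum.inr b) (e₁.symm y) := by
        funext y
        obtain ⟨y, rfl⟩ := e₁.surjective y
        rcases y with i | b' <;> simp [K]
      have h2 : Matrix.vecMul (Matrix.vecMul (f b) LR) NR = f b := by
        rw [Matrix.vecMul_vecMul, hLNR, Matrix.vecMul_one]
      simp only [Matrix.of_apply, Equiv.symm_apply_apply, Sum.elim_inr]
      rw [← h2, h1]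
      simp [Matrix.vecMul, dotProduct, Matrix.mul_apply]
  rw [rowDet_apply, hF, Matrix.det_mul, hdet, Matrix.det_submatrix_equiv_self,
    Matrix.det_fromBlocks_zero₁₂, Matrix.det_one, one_mul, Units.smul_def, zsmul_eq_mul, mul_comm,
    rowDet_apply, ← Matrix.det_submatrix_equiv_self e₂]
  congr 2
  ext b b'
  simp only [Matrix.of_apply, Matrix.submatrix_apply, Equiv.symm_apply_apply,
    FunOnFinite.linearMap_apply_apply, Matrix.vecMul, dotProduct, Finset.sum_filter]
  refine Finset.sum_congr rfl fun e _ => ?_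
  simp [LR, L, eq_comm]

/-- Elimination of generators. If, modulo the relations `c`, every generator `e` equals the
generator `s (π e)`, then the determinant of the relations `c` and further relations is, up to sign,
that of the relations between the generators `A` that are obtained from the further ones by `π`. -/
theorem exists_rowDet_elim {C B I E A : Type*} [Finite E] [DecidableEq E] [Finite A]
    (c : C → E → ℤ) (s : A → E) (π : E → A)
    (h : ∀ e, Pi.single e 1 - Pi.single (s (π e)) 1 ∈ Submodule.span ℤ (Set.range c))
    (σ : C ⊕ B ≃ I) (e : I ≃ E) (e₂ : B ≃ A) :
    ∃ ε : ℤˣ, ∀ r : I → E → R, (∀ i, r (σ (Sum.inl i)) = fun x => (c i x : R)) →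
      rowDet e r = ε • rowDet e₂ fun b => FunOnFinite.linearMap R R π (r (σ (Sum.inr b))) := by
  obtain ⟨ε, hε⟩ := exists_rowDet_sumElim (R := R) c s π h (σ.trans e) e₂
  refine ⟨ε, fun r hr => ?_⟩
  rw [← hε, ← rowDet_reindex e σ r]
  refine congrArg _ (funext fun x => ?_)
  rcases x with i | b
  · exact hr i
  · rfl

end RowDet

/-! ### Laplace expansion along several blocks of rows -/

section Laplace

variable {R : Type*} [CommRing R]

lemma sign_sigmaCongrRight {ι : Type*} {α : ι → Type*} [Fintype ι] [DecidableEq ι]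
    [∀ i, Fintype (α i)] [∀ i, DecidableEq (α i)] (σ : ∀ i, Equiv.Perm (α i)) :
    Equiv.Perm.sign (Equiv.Perm.sigmaCongrRight σ) = ∏ i, Equiv.Perm.sign (σ i) := by
  suffices h : Equiv.Perm.sign.comp (Equiv.Perm.sigmaCongrRightHom α) =
      ∏ i, Equiv.Perm.sign.comp (Pi.evalMonoidHom (fun i => Equiv.Perm (α i)) i) by
    simpa using DFunLike.congr_fun h σ
  refine MonoidHom.pi_ext fun i τ => ?_
  have h1 : Equiv.Perm.sigmaCongrRight (Pi.mulSingle i τ) =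
      τ.viaFintypeEmbedding (Function.Embedding.sigmaMk i) := by
    ext1 ⟨j, x⟩
    by_cases hij : i = j
    · subst hij
      have := τ.viaFintypeEmbedding_apply_image (Function.Embedding.sigmaMk i) x
      simp only [Function.Embedding.sigmaMk_apply] at this
      rw [this]
      simp
    · rw [Equiv.Perm.viaFintypeEmbedding_apply_notMem_range]
      · simp [Pi.mulSingle_eq_of_ne (Ne.symm hij)]
      · rintro ⟨y, hy⟩
        exact hij (congrArg Sigma.fst hy)
  have h2 : Equiv.Perm.sign (Equiv.Perm.sigmaCongrRight (Pi.mulSingle i τ)) =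
      Equiv.Perm.sign τ := by
    rw [h1, Equiv.Perm.viaFintypeEmbedding_sign]
  simp only [MonoidHom.comp_apply, Equiv.Perm.sigmaCongrRightHom_apply, h2,
    MonoidHom.finsetProd_apply]
  rw [Finset.prod_eq_single i]
  · simp
  · intro j _ hj
    simp [Pi.mulSingle_eq_of_ne hj]
  · simp

/-- The columns of a minor: all of `A`, followed by the elements of `I ⊆ X` in increasing order. -/
def minorColumns {A X : Type*} [LinearOrder X] {m : ℕ} (I : Set.powersetCard X m) :
    A ⊕ Fin m → A ⊕ X :=
  Sum.map id (Set.powersetCard.ofFinEmbEquiv.symm I)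

lemma minorColumns_injective {A X : Type*} [LinearOrder X] {m : ℕ} (I : Set.powersetCard X m) :
    Function.Injective (minorColumns (A := A) I) :=
  Function.injective_id.sumMap (Set.powersetCard.ofFinEmbEquiv.symm I).injective

lemma minorColumns_comp_injective {A X : Type*} [LinearOrder X] {m : ℕ} :
    Function.Injective fun y : Set.powersetCard X m × Equiv.Perm (A ⊕ Fin m) =>
      minorColumns (A := A) y.1 ∘ y.2 := by
  rintro ⟨I, σ⟩ ⟨J, τ⟩ h
  have hIJ : I = J := by
    ext x
    have h1 := congrArg (fun f => Sum.inr x ∈ Set.range f) h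
    simp only [EquivLike.range_comp] at h1
    simp only [eq_iff_iff] at h1
    have h2 : ∀ K : Set.powersetCard X m,
        Sum.inr x ∈ Set.range (minorColumns (A := A) K) ↔ x ∈ K := by
      intro K
      rw [← Set.powersetCard.mem_range_ofFinEmbEquiv_symm_iff_mem]
      simp [minorColumns]
    rw [h2, h2] at h1
    exact h1
  subst hIJ
  simp only [Prod.mk.injEq, true_and]
  ext1 s
  exact minorColumns_injective I (congrFun h s)

/-- An injective family of `m + |A|` elements of `A ⊕ X` that contains `A` is a rearrangement of the
columns of a minor. -/
lemma exists_minorColumns_comp_eq {A X : Type*} [Finite A] [LinearOrder X] {m : ℕ}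
    (r : A ⊕ Fin m → A ⊕ X) (hr : Function.Injective r) (hA : ∀ a, Sum.inl a ∈ Set.range r) :
    ∃ (I : Set.powersetCard X m) (σ : Equiv.Perm (A ⊕ Fin m)), minorColumns I ∘ σ = r := by
  classical
  have := Fintype.ofFinite A
  let S : Finset (A ⊕ X) := Finset.univ.image r
  have hS : S = S.toLeft.disjSum S.toRight := Finset.toLeft_disjSum_toRight.symm
  have hl : S.toLeft = Finset.univ := by
    ext a
    simpa [S] using hA a
  have hc : S.card = Fintype.card A + m := by
    rw [Finset.card_image_of_injective _ hr]
    simp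
  have hm : S.toRight.card = m := by
    have h1 := congrArg Finset.card hS
    rw [Finset.card_disjSum, hl, hc, Finset.card_univ] at h1
    omega
  let I : Set.powersetCard X m := ⟨S.toRight, hm⟩
  have hrange : Set.range r = Set.range (minorColumns (A := A) I) := by
    ext y
    rcases y with a | x
    · refine ⟨fun _ => ⟨Sum.inl a, rfl⟩, fun _ => hA a⟩
    · have : Sum.inr x ∈ Set.range (minorColumns (A := A) I) ↔ x ∈ I := by
        rw [← Set.powersetCard.mem_range_ofFinEmbEquiv_symm_iff_mem]
        simp [minorColumns]
      rw [this]
      change _ ↔ x ∈ S.toRight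
      simp [S]
  refine ⟨I, (Equiv.ofInjective r hr).trans ((Equiv.setCongr hrange).trans
    (Equiv.ofInjective _ (minorColumns_injective I)).symm), ?_⟩
  ext1 s
  simp [Equiv.apply_ofInjective_symm]

lemma linearMap_eq_sum {X Y : Type*} [Fintype X] [Finite Y] [DecidableEq Y] (f : X → Y)
    (v : X → R) :
    FunOnFinite.linearMap R R f v = ∑ x, v x • (Pi.single (f x) 1 : Y → R) := by
  ext y
  rw [FunOnFinite.linearMap_apply_apply, Finset.sum_filter, Finset.sum_apply]
  refine Finset.sum_congr rfl fun x _ => ?_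
  simp [Pi.single_apply, eq_comm]

/-- Laplace expansion along several blocks of rows. The block `i` is supported on its own columns
`A i` and, by means of `γ i`, on the common columns `Q`; it contributes its minors on the columns
`A i` together with some of the columns in `X i`. -/
theorem rowDet_laplace {ι : Type*} [Fintype ι] [DecidableEq ι] {A X : ι → Type*}
    [∀ i, Fintype (A i)] [∀ i, DecidableEq (A i)] [∀ i, Fintype (X i)] [∀ i, LinearOrder (X i)]
    {k : ι → ℕ} {B Q : Type*} [Finite Q] [DecidableEq Q]
    (e : (Σ i, A i ⊕ Fin (k i)) ⊕ B ≃ (Σ i, A i) ⊕ Q) (γ : ∀ i, X i → Q)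
    (w : ∀ i, A i ⊕ Fin (k i) → A i ⊕ X i → R) (z : B → Q → R) :
    rowDet e (Sum.elim
      (fun x => FunOnFinite.linearMap R R (Sum.map (Sigma.mk x.1) (γ x.1)) (w x.1 x.2))
      (fun b => FunOnFinite.linearMap R R Sum.inr (z b))) =
    ∑ I : ∀ i, Set.powersetCard (X i) (k i),
      (∏ i, (Matrix.of fun s t => w i s (minorColumns (I i) t)).det) *
      rowDet e (Sum.elim
        (fun x => Pi.single (Sum.map (Sigma.mk x.1) (γ x.1) (minorColumns (I x.1) x.2)) 1)
        (fun b => FunOnFinite.linearMap R R Sum.inr (z b))) := by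
  classical
  have := Fintype.ofFinite Q
  have hfin : Finite ((Σ i, A i ⊕ Fin (k i)) ⊕ B) := Finite.of_equiv _ e.symm
  set zz : B → (Σ i, A i) ⊕ Q → R := fun b => FunOnFinite.linearMap R R Sum.inr (z b) with hzz
  let D : ((x : Σ i, A i ⊕ Fin (k i)) → A x.1 ⊕ X x.1) → R := fun r =>
    rowDet e (Sum.elim (fun x => Pi.single (Sum.map (Sigma.mk x.1) (γ x.1) (r x)) 1) zz)
  -- Expand all rows of the blocks.
  have hL : rowDet e (Sum.elim
      (fun x => FunOnFinite.linearMap R R (Sum.map (Sigma.mk x.1) (γ x.1)) (w x.1 x.2)) zz) =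
      ∑ r : (x : Σ i, A i ⊕ Fin (k i)) → A x.1 ⊕ X x.1, (∏ x, w x.1 x.2 (r x)) * D r := by
    have h1 : ∀ u : (Σ i, A i ⊕ Fin (k i)) → (Σ i, A i) ⊕ Q → R, rowDet e (Sum.elim u zz) =
        (rowDet e).toMultilinearMap.currySum u zz := by
      intro u
      rw [MultilinearMap.currySum_apply]
      change _ = rowDet e _
      congr 1
    simp only [D, h1, linearMap_eq_sum (Sum.map _ _)]
    rw [MultilinearMap.map_sum, sum_apply]
    refine Finset.sum_congr rfl fun r _ => ?_
    rw [MultilinearMap.map_smul_univ, smul_apply, smul_eq_mul]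
  -- A choice of columns that repeats a column or misses one of the `A i` contributes zero.
  have hD : ∀ r, D r ≠ 0 → ∀ i, ∃ (I : Set.powersetCard (X i) (k i))
      (σ : Equiv.Perm (A i ⊕ Fin (k i))), minorColumns I ∘ σ = fun s => r ⟨i, s⟩ := by
    intro r hr i
    apply exists_minorColumns_comp_eq
    · intro s t hst
      by_contra hne
      refine hr ((rowDet e).map_eq_zero_of_eq _ (i := Sum.inl ⟨i, s⟩) (j := Sum.inl ⟨i, t⟩) ?_ ?_)
      · simp only [Sum.elim_inl]
        rw [show r ⟨i, s⟩ = r ⟨i, t⟩ from hst]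
      · simpa using hne
    · intro a
      by_contra hne
      refine hr ?_
      simp only [D]
      rw [rowDet_apply]
      refine Matrix.det_eq_zero_of_column_eq_zero (Sum.inl ⟨i, a⟩) fun y => ?_
      obtain ⟨y, rfl⟩ := e.surjective y
      rw [Matrix.of_apply, Equiv.symm_apply_apply]
      rcases y with ⟨j, s⟩ | b
      · simp only [Sum.elim_inl]
        refine Pi.single_eq_of_ne (fun h => ?_) _
        rcases hy : r ⟨j, s⟩ with a' | x
        · rw [hy] at h
          simp only [Sum.map_inl, Sum.inl.injEq] at h
          cases h
          exact hne ⟨s, hy⟩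
        · rw [hy] at h
          simp at h
      · simp [hzz, FunOnFinite.linearMap_apply_apply]
  have hperm : ∀ (I : ∀ i, Set.powersetCard (X i) (k i))
      (σ : ∀ i, Equiv.Perm (A i ⊕ Fin (k i))),
      D (fun x => minorColumns (I x.1) (σ x.1 x.2)) =
        (∏ i, ((Equiv.Perm.sign (σ i) : ℤ) : R)) * D (fun x => minorColumns (I x.1) x.2) := by
    intro I σ
    have : Finite B := Finite.of_injective (Sum.inr : B → (Σ i, A i ⊕ Fin (k i)) ⊕ B)
      Sum.inr_injective
    have := Fintype.ofFinite B
    have h1 := (rowDet e).map_perm (Sum.elim (fun x : Σ i, A i ⊕ Fin (k i) =>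
      Pi.single (Sum.map (Sigma.mk x.1) (γ x.1) (minorColumns (I x.1) x.2)) (1 : R)) zz)
      (Equiv.Perm.sumCongr (Equiv.Perm.sigmaCongrRight σ) 1)
    have h2 : Equiv.Perm.sign (Equiv.Perm.sumCongr (Equiv.Perm.sigmaCongrRight σ)
        (1 : Equiv.Perm B)) = ∏ i, Equiv.Perm.sign (σ i) := by
      rw [Equiv.Perm.sign_sumCongr, sign_sigmaCongrRight, map_one, mul_one]
    have h3 : ((∏ i, Equiv.Perm.sign (σ i) : ℤˣ) : ℤ) = ∏ i, (Equiv.Perm.sign (σ i) : ℤ) := by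
      simp
    rw [← Int.cast_prod, ← h3, ← zsmul_eq_mul, ← Units.smul_def, ← h2]
    refine Eq.trans ?_ (h1.trans ?_)
    · simp only [D]
      congr 1
      ext1 x
      rcases x with x | x <;> rfl
    · congr!
  rw [hL]
  -- Expand the minors. The terms are those of the first expansion, by `hperm`.
  have hR : ∀ I : ∀ i, Set.powersetCard (X i) (k i),
      (∏ i, (Matrix.of fun s t => w i s (minorColumns (I i) t)).det) *
        D (fun x => minorColumns (I x.1) x.2) =
      ∑ σ : ∀ i, Equiv.Perm (A i ⊕ Fin (k i)),
        (∏ x : Σ i, A i ⊕ Fin (k i), w x.1 x.2 (minorColumns (I x.1) (σ x.1 x.2))) *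
          D (fun x => minorColumns (I x.1) (σ x.1 x.2)) := by
    intro I
    have h1 : ∀ i, (Matrix.of fun s t => w i s (minorColumns (I i) t)).det =
        ∑ σ : Equiv.Perm (A i ⊕ Fin (k i)), ((Equiv.Perm.sign σ : ℤ) : R) *
          ∏ s, w i s (minorColumns (I i) (σ s)) := by
      intro i
      rw [← Matrix.det_transpose, Matrix.det_apply']
      rfl
    simp only [h1, Fintype.prod_sum, Finset.sum_mul, hperm, Finset.prod_mul_distrib,
      Fintype.prod_sigma]
    refine Finset.sum_congr rfl fun σ _ => ?_
    ring
  symm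
  refine Eq.trans (Finset.sum_congr rfl fun I _ => hR I) ?_
  rw [← Fintype.sum_prod_type' fun (I : ∀ i, Set.powersetCard (X i) (k i))
      (σ : ∀ i, Equiv.Perm (A i ⊕ Fin (k i))) =>
        (∏ x : Σ i, A i ⊕ Fin (k i), w x.1 x.2 (minorColumns (I x.1) (σ x.1 x.2))) *
          D (fun x => minorColumns (I x.1) (σ x.1 x.2))]
  refine Fintype.sum_of_injective
    (fun y (x : Σ i, A i ⊕ Fin (k i)) => minorColumns (y.1 x.1) (y.2 x.1 x.2)) ?_ _ _ ?_ ?_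
  · rintro ⟨I, σ⟩ ⟨J, τ⟩ h
    have h1 : ∀ i, (I i, σ i) = (J i, τ i) := fun i =>
      minorColumns_comp_injective (funext fun s => congrFun h ⟨i, s⟩)
    simp only [Prod.mk.injEq] at h1 ⊢
    exact ⟨funext fun i => (h1 i).1, funext fun i => (h1 i).2⟩
  · intro r hr
    by_contra hne
    choose I σ h using hD r (right_ne_zero_of_mul hne)
    exact hr ⟨(I, σ), funext fun x => congrFun (h x.1) x.2⟩
  · intro y
    rfl

/-- Rows with a single entry `1`, in distinct columns, may be deleted together with these
columns. -/
theorem exists_rowDet_cancel {ι : Type*} [Finite ι] {A : ι → Type*}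
    [∀ i, Finite (A i)] {F : ι → Type*} {B Q : Type*} [Finite Q] [DecidableEq Q]
    [DecidableEq (Σ i, A i)]
    (e : (Σ i, A i ⊕ F i) ⊕ B ≃ (Σ i, A i) ⊕ Q) (e' : (Σ i, F i) ⊕ B ≃ Q) :
    ∃ ε : ℤˣ, ∀ (g : (Σ i, F i) → Q → R) (z : B → Q → R),
      rowDet e (Sum.elim
        (fun x => Sum.elim (fun a => Pi.single (Sum.inl ⟨x.1, a⟩) 1)
          (fun l => FunOnFinite.linearMap R R Sum.inr (g ⟨x.1, l⟩)) x.2)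
        (fun b => FunOnFinite.linearMap R R Sum.inr (z b))) =
      ε • rowDet e' (Sum.elim g z) := by
  classical
  have := Fintype.ofFinite ι
  have := fun i => Fintype.ofFinite (A i)
  have := Fintype.ofFinite Q
  let σ : (Σ i, A i ⊕ F i) ⊕ B ≃ (Σ i, A i) ⊕ ((Σ i, F i) ⊕ B) :=
    ((Equiv.sigmaSumDistrib A F).sumCongr (Equiv.refl B)).trans (Equiv.sumAssoc _ _ _)
  let e'' : (Σ i, A i ⊕ F i) ⊕ B ≃ (Σ i, A i) ⊕ Q := σ.trans ((Equiv.refl _).sumCongr e')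
  obtain ⟨ε, hε⟩ := rowDet_eq_sign_smul (R := R) e e''
  refine ⟨ε, fun g z => ?_⟩
  have h := Matrix.det_fromBlocks_zero₁₂ (1 : Matrix (Σ i, A i) (Σ i, A i) R) 0
    (Matrix.of fun x y => Sum.elim g z (e'.symm x) y)
  rw [Matrix.det_one, one_mul] at h
  rw [hε, rowDet_apply, rowDet_apply, ← h]
  congr 2
  ext x y
  obtain ⟨x, rfl⟩ := e''.surjective x
  rw [Matrix.of_apply, Equiv.symm_apply_apply]
  rcases x with ⟨i, a | l⟩ | b <;> rcases y with y | y <;>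
    simp [e'', σ, Matrix.one_apply, Pi.single_apply, FunOnFinite.linearMap_apply_apply,
      Finset.sum_filter, eq_comm]

end Laplace

/-! ### Volume forms of decomposable elements -/

section Volume

/-- The product of vectors, taken in the order of a list of all indices, has their determinant as
its volume, up to a sign that does not depend on the vectors. -/
lemma exists_volumeForm_prod {μ q : ℕ} {I : Type*} (L : List I) (hL : L.Nodup) (hL' : ∀ i, i ∈ L)
    (e : I ≃ Fin q) :
    ∃ ε : ℤˣ, ∀ v : I → Fin q → Laurent μ,
      volumeForm μ q (L.map fun i => ExteriorAlgebra.ι (Laurent μ) (v i)).prod =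
        ε • rowDet e v := by
  classical
  let e₁ : Fin L.length ≃ I := hL.getEquivOfForallMemList L hL'
  obtain rfl : L.length = q := Fin.equiv_iff_eq.1 ⟨e₁.trans e⟩
  obtain ⟨ε, hε⟩ := rowDet_eq_sign_smul (R := Laurent μ) e₁.symm e
  refine ⟨ε, fun v => ?_⟩
  have h1 : (L.map fun i => ExteriorAlgebra.ι (Laurent μ) (v i)).prod =
      ExteriorAlgebra.ιMulti (Laurent μ) L.length (v ∘ L.get) := by
    rw [ExteriorAlgebra.ιMulti_apply, ← List.ofFn_getElem_eq_map]
    rfl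
  rw [h1, volumeForm, ExteriorAlgebra.liftAlternating_apply_ιMulti, Pi.single_eq_same, ← hε,
    rowDet_apply]
  rfl

/-- The volume form of a product of decomposable elements is a determinant. -/
lemma exists_volumeForm_wedge {μ q p n : ℕ} {k : Fin p → ℕ}
    (e : (Σ i, Fin (k i)) ⊕ Fin n ≃ Fin q) :
    ∃ ε : ℤˣ, ∀ (v : ∀ i, Fin (k i) → Fin q → Laurent μ) (y : Fin n → Fin q → Laurent μ),
      volumeForm μ q ((List.ofFn fun i => ExteriorAlgebra.ιMulti (Laurent μ) (k i) (v i)).prod *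
        ExteriorAlgebra.ιMulti (Laurent μ) n y) =
        ε • rowDet e (Sum.elim (fun x => v x.1 x.2) y) := by
  let L : List ((Σ i, Fin (k i)) ⊕ Fin n) :=
    (List.finRange p).flatMap (fun i => (List.finRange (k i)).map fun l => Sum.inl ⟨i, l⟩) ++
      (List.finRange n).map Sum.inr
  have hL : L.Nodup := by
    refine List.Nodup.append ?_ ((List.nodup_finRange n).map Sum.inr_injective) ?_
    · refine List.nodup_flatMap.2 ⟨fun i _ => (List.nodup_finRange _).map ?_, ?_⟩
      · intro a b h
        simpa using h
      · refine (List.nodup_finRange p).pairwise_of_forall_ne ?_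
        intro i _ j _ hij
        simp [Function.onFun, List.disjoint_left, hij.symm]
    · simp [List.disjoint_left]
  have hL' : ∀ x, x ∈ L := by
    rintro (⟨i, l⟩ | b)
    · simp [L]
    · simp [L]
  obtain ⟨ε, hε⟩ := exists_volumeForm_prod (μ := μ) L hL hL' e
  refine ⟨ε, fun v y => ?_⟩
  rw [← hε]
  congr 1
  simp only [L, List.map_append, List.prod_append, List.map_map, List.flatMap_def, List.map_flatten,
    List.prod_flatten, Function.comp_def, ExteriorAlgebra.ιMulti_apply, List.ofFn_eq_map]
  rfl

end Volume

/-! ### The pairing on half-dimensional forms and the map `γ` -/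

section Pairing

variable (μ n : ℕ)

/-- The pairing `(u, w) ↦ ω_∂ (u ∧ w)` on `⋀^n H_∂`. -/
def wedgePairing : ⋀[Laurent μ]^n (BoundaryModule μ n) →ₗ[Laurent μ]
    Module.Dual (Laurent μ) (⋀[Laurent μ]^n (BoundaryModule μ n)) :=
  ((LinearMap.mul (Laurent μ) (ExteriorAlgebra (Laurent μ) (BoundaryModule μ n))).compl₁₂
    (Submodule.subtype _) (Submodule.subtype _)).compr₂ (volumeForm μ (2 * n))

variable {μ n}

lemma wedgePairing_apply (u w : ⋀[Laurent μ]^n (BoundaryModule μ n)) :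
    wedgePairing μ n u w = volumeForm μ (2 * n) (u.1 * w.1) := rfl

/-- The complement of a set of half of the marked points. -/
def halfCompl (n : ℕ) :
    Set.powersetCard (Fin (2 * n)) n ≃ Set.powersetCard (Fin (2 * n)) n :=
  Set.powersetCard.compl (by rw [Fintype.card_fin, two_mul])

/-- As `x_I ∧ x_J = 0` unless `J` is the complement of `I`, the pairing sends the standard basis to
the dual basis, up to units and the order of the elements. -/
lemma exists_wedgePairing_basis (I : Set.powersetCard (Fin (2 * n)) n) :
    ∃ ε : (Laurent μ)ˣ,
      wedgePairing μ n ((Pi.basisFun (Laurent μ) (Fin (2 * n))).exteriorPower n I) =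
      ε • ((Pi.basisFun (Laurent μ) (Fin (2 * n))).exteriorPower n).coord (halfCompl n I) := by
  classical
  let b := Pi.basisFun (Laurent μ) (Fin (2 * n))
  have hdis : ∀ J : Set.powersetCard (Fin (2 * n)) n, Disjoint I.1 J.1 → J = halfCompl n I := by
    intro J h
    apply Subtype.ext
    change J.1 = (I.1)ᶜ
    refine Finset.eq_of_subset_of_card_le (fun x hx => ?_) (le_of_eq ?_)
    · exact Finset.mem_compl.2 fun hx' => Finset.disjoint_left.1 h hx' hx
    · exact (halfCompl n I).2.trans J.2.symm
  -- For `J` the complement of `I`, the determinant is that of a permutation matrix.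
  have hunit : IsUnit (wedgePairing μ n (b.exteriorPower n I)
      (b.exteriorPower n (halfCompl n I))) := by
    let f : Fin (n + n) → Fin (2 * n) := Fin.append (Set.powersetCard.ofFinEmbEquiv.symm I)
      (Set.powersetCard.ofFinEmbEquiv.symm (halfCompl n I))
    have hf : Function.Bijective f := by
      refine (Fintype.bijective_iff_injective_and_card f).2 ⟨?_, by simp [two_mul]⟩
      refine Fin.append_injective_iff.2 ⟨(Set.powersetCard.ofFinEmbEquiv.symm I).injective,
        (Set.powersetCard.ofFinEmbEquiv.symm (halfCompl n I)).injective, fun i j h => ?_⟩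
      have h1 := (Set.powersetCard.mem_range_ofFinEmbEquiv_symm_iff_mem I _).1 ⟨i, rfl⟩
      have h2 := (Set.powersetCard.mem_range_ofFinEmbEquiv_symm_iff_mem (halfCompl n I) _).1
        ⟨j, rfl⟩
      rw [← h, halfCompl, Set.powersetCard.mem_compl] at h2
      exact h2 h1
    obtain ⟨ε, hε⟩ := exists_volumeForm_prod (μ := μ) _ (List.nodup_finRange (n + n))
      List.mem_finRange (Equiv.ofBijective f hf)
    have h1 : wedgePairing μ n (b.exteriorPower n I) (b.exteriorPower n (halfCompl n I)) =
        ε • rowDet (Equiv.ofBijective f hf) fun i => b (f i) := by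
      rw [← hε, wedgePairing_apply, exteriorPower.basis_apply, exteriorPower.basis_apply]
      simp only [exteriorPower.ιMulti_family_apply_coe, ExteriorAlgebra.ιMulti_family]
      rw [ExteriorAlgebra.ιMulti_mul_ιMulti, ExteriorAlgebra.ιMulti_apply, List.ofFn_eq_map]
      congr 3
      ext1 i
      refine congrArg _ ?_
      refine Fin.addCases (fun i => ?_) (fun i => ?_) i <;>
        simp only [f, Fin.append_left, Fin.append_right, Function.comp_apply]
    have h2 : rowDet (Equiv.ofBijective f hf) (fun i => b (f i)) = 1 := by
      rw [rowDet_apply, ← Matrix.det_one (n := Fin (2 * n))]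
      congr 1
      ext x y
      simp [b, Matrix.one_apply, Pi.single_apply, eq_comm, Equiv.ofBijective_apply_symm_apply]
    rw [h1, h2, Units.smul_def, zsmul_eq_mul, mul_one]
    exact ε.isUnit.map (Int.castRingHom (Laurent μ))
  obtain ⟨ε, hε⟩ := hunit
  refine ⟨ε, (b.exteriorPower n).ext fun J => ?_⟩
  by_cases hJ : J = halfCompl n I
  · subst hJ
    rw [← hε]
    simp [b, Units.smul_def]
  · rw [wedgePairing_apply, exteriorPower.basis_apply, exteriorPower.basis_apply]
    simp only [exteriorPower.ιMulti_family_apply_coe]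
    rw [ExteriorAlgebra.ιMulti_family_mul_of_not_disjoint _ _ _ _ fun h => hJ (hdis J h),
      map_zero]
    rw [LinearMap.smul_apply, Module.Basis.coord_apply, ← exteriorPower.basis_apply,
      Module.Basis.repr_self, Finsupp.single_eq_of_ne (Ne.symm hJ), smul_zero]

lemma wedgePairing_bijective : Function.Bijective (wedgePairing μ n) := by
  classical
  choose ε hε using exists_wedgePairing_basis (μ := μ) (n := n)
  let b := (Pi.basisFun (Laurent μ) (Fin (2 * n))).exteriorPower n
  let c := (b.dualBasis.reindex (halfCompl n).symm).unitsSMul ε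
  have h : wedgePairing μ n = (b.equiv c (Equiv.refl _)).toLinearMap := by
    refine b.ext fun I => ?_
    rw [hε, LinearEquiv.coe_coe, Module.Basis.equiv_apply, Module.Basis.unitsSMul_apply,
      Module.Basis.reindex_apply]
    simp [b]
  rw [h]
  exact (b.equiv c (Equiv.refl _)).bijective

end Pairing

namespace CircuitDiagram

variable {μ n p : ℕ} {k : Fin p → ℕ} {inward : Fin (2 * n) → Bool}
  {inner : ∀ i, Fin (2 * k i) → Bool}

/-- The defining property of `γ` prescribes its composition with the perfect pairing. -/
theorem existsUnique_isGamma (P : CircuitDiagram μ inward inner) : ∃! γ, P.IsGamma γ := by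
  let Φ : Source μ k →ₗ[Laurent μ] Module.Dual (Laurent μ) (⋀[Laurent μ]^n (BoundaryModule μ n)) :=
    ((LinearMap.mul (Laurent μ) (ExteriorAlgebra (Laurent μ) P.CurveModule)).compl₁₂ P.innerWedge
      ((ExteriorAlgebra.map P.outerMap).toLinearMap ∘ₗ Submodule.subtype _)).compr₂
        (volumeForm μ P.q)
  let E := LinearEquiv.ofBijective _ (wedgePairing_bijective (μ := μ) (n := n))
  have h : ∀ γ, P.IsGamma γ ↔ wedgePairing μ n ∘ₗ γ = Φ := by
    intro γ
    constructor
    · intro h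
      exact LinearMap.ext fun x => LinearMap.ext fun y => (h x y).symm
    · intro h x y
      exact (LinearMap.congr_fun (LinearMap.congr_fun h x) y).symm
  refine ⟨E.symm.toLinearMap ∘ₗ Φ, (h _).2 ?_, fun γ hγ => ?_⟩
  · refine LinearMap.ext fun x => E.apply_symm_apply (Φ x)
  · rw [← (h γ).1 hγ]
    refine LinearMap.ext fun x => (E.symm_apply_apply (γ x)).symm

end CircuitDiagram

/-! ### Relations between the edges of a diagram -/

section Rows

variable {R : Type*} [CommRing R]

open Classical in
/-- The relation `a - d`. -/
def pointRow (R : Type*) [CommRing R] {X : Type*} (a d : X) : X → R :=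
  Pi.single a 1 + Pi.single d (-1)

lemma pointRow_eq_sub {X : Type*} [DecidableEq X] (a d : X) :
    pointRow R a d = Pi.single a 1 - Pi.single d 1 := by
  unfold pointRow
  rw [sub_eq_add_neg, ← Pi.single_neg]
  congr!

open Classical in
/-- The relation at a crossing with upper generator `b`, incoming lower generator `a` and outgoing
lower generator `d`; the lower and the upper colors are `ti` and `tj`. -/
def crossingRow {X : Type*} (positive : Bool) (ti tj : R) (a b d : X) : X → R :=
  if positive = true then Pi.single a tj + Pi.single b (1 - ti) + Pi.single d (-1)
  else Pi.single a (-1) + Pi.single b (1 - ti) + Pi.single d tj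

lemma linearMap_pointRow {X Y : Type*} [Finite X] [Finite Y] (f : X → Y) (a d : X) :
    FunOnFinite.linearMap R R f (pointRow R a d) = pointRow R (f a) (f d) := by
  classical
  simp only [pointRow, map_add, FunOnFinite.linearMap_piSingle]

lemma linearMap_crossingRow {X Y : Type*} [Finite X] [Finite Y] (f : X → Y) (pos : Bool)
    (ti tj : R) (a b d : X) :
    FunOnFinite.linearMap R R f (crossingRow pos ti tj a b d) =
      crossingRow pos ti tj (f a) (f b) (f d) := by
  classical
  unfold crossingRow
  split <;> simp only [map_add, FunOnFinite.linearMap_piSingle]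

lemma cast_pointRow {X : Type*} (a d : X) : (fun x => (pointRow ℤ a d x : R)) = pointRow R a d := by
  classical
  ext x
  simp only [pointRow, Pi.add_apply, Pi.single_apply]
  split <;> split <;> simp

lemma linearMap_linearMap {X Y Z : Type*} [Finite X] [Finite Y] [Finite Z] (f : X → Y) (g : Y → Z)
    (v : X → R) : FunOnFinite.linearMap R R g (FunOnFinite.linearMap R R f v) =
      FunOnFinite.linearMap R R (g ∘ f) v := by
  rw [FunOnFinite.linearMap_comp]
  rfl

end Rows

namespace WeldedTangle

variable {μ n : ℕ} {inward : Fin (2 * n) → Bool}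

section Finiteness

variable (T : WeldedTangle μ inward)

instance finite_site : Finite (Site T.Crossing T.Point) := by
  have := T.finite_crossing
  have := T.finite_point
  refine Finite.of_surjective (Sum.elim Site.upper (Sum.elim Site.lower Site.point) :
    T.Crossing ⊕ T.Crossing ⊕ T.Point → Site T.Crossing T.Point) ?_
  rintro (c | c | a)
  · exact ⟨Sum.inl c, rfl⟩
  · exact ⟨Sum.inr (Sum.inl c), rfl⟩
  · exact ⟨Sum.inr (Sum.inr a), rfl⟩

instance finite_edge : Finite T.Edge := Finite.of_equiv _ T.tail.symm

instance finite_arc : Finite T.Arc := inferInstanceAs (Finite (Quot _))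

instance finite_internalArc : Finite T.InternalArc := inferInstanceAs (Finite (Subtype _))

end Finiteness

lemma card_inward_add (f : Fin (2 * n) → Bool) :
    Nat.card {j // f j = true} + Nat.card {j // f j = false} = 2 * n := by
  rw [← Nat.card_sum]
  have e : {j // f j = false} ≃ {j // ¬ f j = true} := Equiv.subtypeEquivRight (by simp)
  rw [Nat.card_congr ((Equiv.sumCongr (Equiv.refl _) e).trans
    (Equiv.sumCompl fun j => f j = true))]
  simp

lemma nonempty_edgeEquiv (T : WeldedTangle μ inward) :
    Nonempty (Site T.Crossing T.Point ⊕ Fin n ≃ T.Edge) := by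
  have h1 := Nat.card_congr T.tail
  have h2 := Nat.card_congr T.head
  rw [Nat.card_sum] at h1 h2
  have h3 := card_inward_add inward
  have h4 : Nat.card (Site T.Crossing T.Point ⊕ Fin n) = Nat.card T.Edge := by
    rw [Nat.card_sum, Nat.card_fin]
    omega
  exact ⟨(Finite.equivFin _).trans ((finCongr h4).trans (Finite.equivFin _).symm)⟩

/-- The relations between the edges of a diagram, one for each interior site. -/
def siteRow (T : WeldedTangle μ inward) : Site T.Crossing T.Point → T.Edge → Laurent μ
  | Site.upper c => pointRow _ (T.inEdge (Site.upper c)) (T.outEdge (Site.upper c))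
  | Site.lower c => crossingRow (T.positive c) (Laurent.t (T.color (T.inEdge (Site.lower c))))
      (Laurent.t (T.color (T.inEdge (Site.upper c)))) (T.inEdge (Site.lower c))
      (T.inEdge (Site.upper c)) (T.outEdge (Site.lower c))
  | Site.point a => pointRow _ (T.inEdge (Site.point a)) (T.outEdge (Site.point a))

/-- The determinant of the relations between the edges of a diagram, together with `n` vectors
`y l ∈ H_∂`, where a marked point is sent to the edge ending there. As an alternating form in `y` it
is, for interrupted diagrams, the pairing with `± α`; but it makes sense for all diagrams. -/
def edgeForm (T : WeldedTangle μ inward) (e : Site T.Crossing T.Point ⊕ Fin n ≃ T.Edge)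
    (y : Fin n → BoundaryModule μ n) : Laurent μ :=
  rowDet e (Sum.elim T.siteRow fun l =>
    FunOnFinite.linearMap (Laurent μ) (Laurent μ) T.boundaryEdge (y l))

/-- Removing auxiliary points `pt c` does not change `edgeForm`, up to sign: the edges of `T'` are
merged to edges of `T` by `π`, and the relation at `pt c` identifies an edge with the representative
`s (π e)` of the merged edge. -/
theorem exists_edgeForm_collapse {T T' : WeldedTangle μ inward} {C : Type} (pt : C → T'.Point)
    (f : T.Crossing → T'.Crossing) (g : T.Point → T'.Point) (hf : Function.Bijective f)
    (hg : Function.Bijective (Sum.elim pt g)) (π : T'.Edge → T.Edge) (s : T.Edge → T'.Edge)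
    (hs : ∀ e, e = s (π e) ∨ ∃ c,
      (T'.inEdge (Site.point (pt c)) = e ∧ T'.outEdge (Site.point (pt c)) = s (π e)) ∨
      (T'.outEdge (Site.point (pt c)) = e ∧ T'.inEdge (Site.point (pt c)) = s (π e)))
    (hin : ∀ x, π (T'.inEdge (Site.map f g x)) = T.inEdge x)
    (hout : ∀ x, π (T'.outEdge (Site.map f g x)) = T.outEdge x)
    (hpos : ∀ c, T'.positive (f c) = T.positive c)
    (hcol : ∀ e, T'.color e = T.color (π e))
    (hb : ∀ j, π (T'.boundaryEdge j) = T.boundaryEdge j)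
    (e : Site T.Crossing T.Point ⊕ Fin n ≃ T.Edge)
    (e' : Site T'.Crossing T'.Point ⊕ Fin n ≃ T'.Edge) :
    ∃ ε : ℤˣ, ∀ y, T'.edgeForm e' y = ε • T.edgeForm e y := by
  classical
  let σ₀ : C ⊕ (Site T.Crossing T.Point ⊕ Fin n) → Site T'.Crossing T'.Point ⊕ Fin n :=
    Sum.elim (fun c => Sum.inl (Site.point (pt c))) (Sum.map (Site.map f g) id)
  have hσ : Function.Bijective σ₀ := by
    constructor
    · rintro (c | (c | c | a) | l) (c' | (c' | c' | a') | l') h <;>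
        simp only [σ₀, Sum.elim_inl, Sum.elim_inr, Sum.map_inl, Sum.map_inr, Site.map,
          Sum.inl.injEq, Sum.inr.injEq, Site.point.injEq, Site.upper.injEq, Site.lower.injEq,
          reduceCtorEq, id_eq] at h
      · exact congrArg Sum.inl (Sum.inl_injective (hg.1 (a₁ := Sum.inl c) (a₂ := Sum.inl c') h))
      · exact absurd (hg.1 (a₁ := Sum.inl c) (a₂ := Sum.inr a') h) (by simp)
      · rw [hf.1 h]
      · rw [hf.1 h]
      · exact absurd (hg.1 (a₁ := Sum.inr a) (a₂ := Sum.inl c') h) (by simp)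
      · rw [Sum.inr_injective (hg.1 (a₁ := Sum.inr a) (a₂ := Sum.inr a') h)]
      · rw [h]
    · rintro ((c | c | a) | l)
      · obtain ⟨c, rfl⟩ := hf.2 c
        exact ⟨Sum.inr (Sum.inl (Site.upper c)), rfl⟩
      · obtain ⟨c, rfl⟩ := hf.2 c
        exact ⟨Sum.inr (Sum.inl (Site.lower c)), rfl⟩
      · obtain ⟨c | a, rfl⟩ := hg.2 a
        · exact ⟨Sum.inl c, rfl⟩
        · exact ⟨Sum.inr (Sum.inl (Site.point a)), rfl⟩
      · exact ⟨Sum.inr (Sum.inr l), rfl⟩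
  let r : C → T'.Edge → ℤ := fun c =>
    pointRow ℤ (T'.inEdge (Site.point (pt c))) (T'.outEdge (Site.point (pt c)))
  have hr : ∀ e, Pi.single e 1 - Pi.single (s (π e)) 1 ∈ Submodule.span ℤ (Set.range r) := by
    intro e
    rcases hs e with h | ⟨c, ⟨h1, h2⟩ | ⟨h1, h2⟩⟩
    · rw [← h, sub_self]
      exact Submodule.zero_mem _
    · have h3 : Pi.single e 1 - Pi.single (s (π e)) 1 = r c := by
        simp only [r]
        rw [pointRow_eq_sub, h1, h2]
      rw [h3]
      exact Submodule.subset_span ⟨c, rfl⟩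
    · have h3 : Pi.single e 1 - Pi.single (s (π e)) 1 = - r c := by
        simp only [r]
        rw [pointRow_eq_sub, h1, h2, neg_sub]
      rw [h3]
      exact Submodule.neg_mem _ (Submodule.subset_span ⟨c, rfl⟩)
  obtain ⟨ε, hε⟩ := exists_rowDet_elim (R := Laurent μ) r s π hr (Equiv.ofBijective σ₀ hσ) e' e
  refine ⟨ε, fun y => ?_⟩
  rw [edgeForm, edgeForm, hε]
  · congr 2
    funext x
    rcases x with (c | c | a) | l
    · have h1 := hin (Site.upper c)
      have h2 := hout (Site.upper c)
      simp only [Site.map] at h1 h2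
      simp [σ₀, siteRow, Site.map, linearMap_pointRow, h1, h2]
    · have h1 := hin (Site.upper c)
      have h2 := hout (Site.lower c)
      have h3 := hin (Site.lower c)
      simp only [Site.map] at h1 h2 h3
      simp [σ₀, siteRow, Site.map, linearMap_crossingRow, h1, h2, h3, hpos, hcol]
    · have h1 := hin (Site.point a)
      have h2 := hout (Site.point a)
      simp only [Site.map] at h1 h2
      simp [σ₀, siteRow, Site.map, linearMap_pointRow, h1, h2]
    · simp only [σ₀, Equiv.ofBijective_apply, Sum.elim_inr, Sum.map_inr, id_eq]
      rw [linearMap_linearMap, funext hb (f := π ∘ T'.boundaryEdge)]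
  · intro c
    exact (cast_pointRow _ _).symm

lemma Iso.exists_edgeForm {T T' : WeldedTangle μ inward} (h : T.Iso T')
    (e : Site T.Crossing T.Point ⊕ Fin n ≃ T.Edge)
    (e' : Site T'.Crossing T'.Point ⊕ Fin n ≃ T'.Edge) :
    ∃ ε : ℤˣ, ∀ y, T'.edgeForm e' y = ε • T.edgeForm e y := by
  obtain ⟨f, g, h, hpos, ht, hh, hc⟩ := h
  have hin : ∀ x, h.symm (T'.inEdge (Site.map f g x)) = T.inEdge x := by
    intro x
    rw [Equiv.symm_apply_eq, inEdge, Equiv.symm_apply_eq, hh]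
    simp [inEdge]
  have hout : ∀ x, h.symm (T'.outEdge (Site.map f g x)) = T.outEdge x := by
    intro x
    rw [Equiv.symm_apply_eq, outEdge, Equiv.symm_apply_eq, ht]
    simp [outEdge]
  refine exists_edgeForm_collapse (C := Empty) Empty.elim f g f.bijective ?_ h.symm h
    (fun e => Or.inl (by simp)) hin hout hpos (fun e => by rw [← hc]; simp) ?_ e e'
  · refine ⟨?_, fun x => ⟨Sum.inr (g.symm x), by simp⟩⟩
    rintro (x | x) (y | y) hxy
    · exact x.elim
    · exact x.elim
    · exact y.elim
    · exact congrArg Sum.inr (g.injective hxy)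
  · intro j
    rw [Equiv.symm_apply_eq]
    by_cases hj : inward j = true
    · rw [boundaryEdge, boundaryEdge, dif_pos hj, dif_pos hj, Equiv.symm_apply_eq, ht]
      simp
    · rw [boundaryEdge, boundaryEdge, dif_neg hj, dif_neg hj, Equiv.symm_apply_eq, hh]
      simp

/-- The new point identifies the new edge `none` with the other half `some e₀` of the divided
edge. -/
lemma exists_edgeForm_insertPoint (T : WeldedTangle μ inward) (e₀ : T.Edge)
    (e : Site T.Crossing T.Point ⊕ Fin n ≃ T.Edge)
    (e' : Site (T.insertPoint e₀).Crossing (T.insertPoint e₀).Point ⊕ Fin n ≃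
      (T.insertPoint e₀).Edge) :
    ∃ ε : ℤˣ, ∀ y, (T.insertPoint e₀).edgeForm e' y = ε • T.edgeForm e y := by
  classical
  have key : ∀ x : Option T.Edge, (Equiv.swap none (some e₀) x).getD e₀ = x.getD e₀ := by
    intro x
    rcases x with _ | x
    · simp
    · by_cases h : x = e₀
      · subst h; simp
      · rw [Equiv.swap_apply_of_ne_of_ne (by simp) (by simpa using h)]
  refine exists_edgeForm_collapse (T := T) (T' := T.insertPoint e₀) (C := Unit) (fun _ => none) id
    some Function.bijective_id ?_ (fun x => Option.getD x e₀) some ?_ ?_ ?_ (fun _ => rfl)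
    (fun _ => rfl) ?_ e e'
  · constructor
    · rintro (x | x) (y | y) h
      · rfl
      · exact absurd h (Option.some_ne_none y).symm
      · exact absurd h (Option.some_ne_none x)
      · exact congrArg Sum.inr (Option.some_injective _ h)
    · rintro (_ | x)
      · exact ⟨Sum.inl (), rfl⟩
      · exact ⟨Sum.inr x, rfl⟩
  · rintro (_ | x)
    · refine Or.inr ⟨(), Or.inr ⟨rfl, ?_⟩⟩
      change (Equiv.swap none (some e₀)).symm none = some e₀
      simp
    · exact Or.inl rfl
  · intro x
    change ((Equiv.swap none (some e₀)).symm
      ((addEdge T.head).symm (Sum.inr (Site.map id some x)))).getD e₀ = _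
    rw [Equiv.symm_swap, key]
    rcases x with c | c | a <;> rfl
  · intro x
    rcases x with c | c | a <;> rfl
  · intro j
    by_cases hj : inward j = true
    · rw [boundaryEdge, boundaryEdge, dif_pos hj, dif_pos hj]
      rfl
    · rw [boundaryEdge, boundaryEdge, dif_neg hj, dif_neg hj]
      change ((Equiv.swap none (some e₀)).symm
        ((addEdge T.head).symm (Sum.inl ⟨j, by simpa using hj⟩))).getD e₀ = _
      rw [Equiv.symm_swap, key]
      rfl

lemma Subdivision.exists_edgeForm {T T' : WeldedTangle μ inward} (h : Subdivision T T')
    (e : Site T.Crossing T.Point ⊕ Fin n ≃ T.Edge)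
    (e' : Site T'.Crossing T'.Point ⊕ Fin n ≃ T'.Edge) :
    ∃ ε : ℤˣ, ∀ y, T'.edgeForm e' y = ε • T.edgeForm e y := by
  induction h with
  | iso h => exact h.exists_edgeForm e e'
  | @insert T₁ T₂ e₀ _ h ih =>
    obtain ⟨e₁⟩ := T₁.nonempty_edgeEquiv
    obtain ⟨e₂⟩ := (T₁.insertPoint e₀).nonempty_edgeEquiv
    obtain ⟨ε₁, h₁⟩ := ih e₁
    obtain ⟨ε₂, h₂⟩ := exists_edgeForm_insertPoint T₁ e₀ e₁ e₂
    obtain ⟨ε₃, h₃⟩ := h.exists_edgeForm e₂ e'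
    exact ⟨ε₃ * (ε₂ * ε₁), fun y => by rw [h₃, h₂, h₁, mul_smul, mul_smul]⟩

end WeldedTangle

/-! ### The alternating form of a glued diagram -/

namespace WeldedTangle

variable {μ n : ℕ} {inward : Fin (2 * n) → Bool}

/-- The arcs of an interrupted diagram are the internal arcs and the arcs at the marked points. -/
def arcEquiv (T : WeldedTangle μ inward) (hT : T.IsInterrupted) :
    T.InternalArc ⊕ Fin (2 * n) ≃ T.Arc :=
  Equiv.ofBijective (Sum.elim Subtype.val T.boundaryArc) (by
    classical
    constructor
    · rintro (a | j) (b | j') h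
      · exact congrArg Sum.inl (Subtype.ext h)
      · exact absurd ⟨j', h.symm⟩ a.2
      · exact absurd ⟨j, h⟩ b.2
      · exact congrArg Sum.inr (hT.1 h)
    · intro a
      by_cases ha : a ∈ Set.range T.boundaryArc
      · obtain ⟨j, rfl⟩ := ha
        exact ⟨Sum.inr j, rfl⟩
      · exact ⟨Sum.inl ⟨a, ha⟩, rfl⟩)

/-- The rows of the matrix of an interrupted diagram, with the columns sorted into internal arcs and
arcs at the marked points. -/
def sortedRow (T : WeldedTangle μ inward) (ρ : T.RowOrder) (s : T.InternalArc ⊕ Fin n) :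
    T.InternalArc ⊕ Fin (2 * n) → Laurent μ :=
  fun x => T.matrix (ρ s) (Sum.elim Subtype.val T.boundaryArc x)

lemma minor_eq (T : WeldedTangle μ inward) (ρ : T.RowOrder) [Fintype T.InternalArc]
    [DecidableEq T.InternalArc] (I : Set.powersetCard (Fin (2 * n)) n) :
    T.minor ρ I = (Matrix.of fun s t => T.sortedRow ρ s (minorColumns I t)).det := by
  have h : (Matrix.of fun s t => T.sortedRow ρ s (minorColumns I t)) =
      T.matrix.submatrix ρ (Sum.elim (fun a : T.InternalArc => a.1)
        fun l => T.boundaryArc (Set.powersetCard.ofFinEmbEquiv.symm I l)) := by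
    ext s (t | t) <;> rfl
  rw [h, minor]
  congr!

/-- The interior site at which the arcs of a row are interrupted. -/
def rowSite (T : WeldedTangle μ inward) : T.Row → Site T.Crossing T.Point :=
  Sum.elim Site.lower Site.point

/-- The rows of the matrix are the relations between edges at lower preimages and auxiliary points,
read as relations between arcs. -/
lemma matrix_row (T : WeldedTangle μ inward) (r : T.Row) :
    T.matrix r = FunOnFinite.linearMap (Laurent μ) (Laurent μ) T.arc (T.siteRow (T.rowSite r)) := by
  rcases r with c | a
  · simp only [rowSite, Sum.elim_inl, siteRow, linearMap_crossingRow]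
    rfl
  · simp only [rowSite, Sum.elim_inr, siteRow, linearMap_pointRow]
    rfl

lemma sortedRow_eq (T : WeldedTangle μ inward) (hT : T.IsInterrupted) (ρ : T.RowOrder)
    (s : T.InternalArc ⊕ Fin n) :
    T.sortedRow ρ s = FunOnFinite.linearMap (Laurent μ) (Laurent μ)
      (fun e => (T.arcEquiv hT).symm (T.arc e)) (T.siteRow (T.rowSite (ρ s))) := by
  classical
  have := Fintype.ofFinite T.Arc
  rw [show (fun e => (T.arcEquiv hT).symm (T.arc e)) = (T.arcEquiv hT).symm ∘ T.arc from rfl,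
    ← linearMap_linearMap, ← matrix_row]
  ext x
  rw [FunOnFinite.linearMap_apply_apply, Finset.sum_eq_single (T.arcEquiv hT x)]
  · rfl
  · intro a ha hne
    simp only [Finset.mem_filter, Finset.mem_univ, true_and] at ha
    exact absurd (by rw [← ha, Equiv.apply_symm_apply]) hne
  · simp

/-- The relations at the upper preimages of crossings identify all edges of an arc. -/
lemma single_sub_single_mem_of_arc_eq (T : WeldedTangle μ inward) {F : Type*} [DecidableEq F]
    (f : T.Edge → F) (M : Submodule ℤ (F → ℤ))
    (hM : ∀ c, (Pi.single (f (T.inEdge (Site.upper c))) 1 -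
      Pi.single (f (T.outEdge (Site.upper c))) 1 : F → ℤ) ∈ M) {e e' : T.Edge}
    (h : T.arc e = T.arc e') : (Pi.single (f e) 1 - Pi.single (f e') 1 : F → ℤ) ∈ M := by
  have key : ∀ x y, Relation.EqvGen (fun e f : T.Edge =>
      ∃ c, e = T.inEdge (Site.upper c) ∧ f = T.outEdge (Site.upper c)) x y →
      (Pi.single (f x) 1 - Pi.single (f y) 1 : F → ℤ) ∈ M := by
    intro x y h
    induction h with
    | rel _ _ h =>
      obtain ⟨c, rfl, rfl⟩ := h
      exact hM c
    | refl _ => simp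
    | symm x y _ ih =>
      rw [← neg_sub]
      exact M.neg_mem ih
    | trans x y z _ _ ih₁ ih₂ =>
      rw [← sub_add_sub_cancel _ (Pi.single (f y) 1)]
      exact M.add_mem ih₁ ih₂
  exact key e e' (Quot.eqvGen_exact h)

end WeldedTangle

namespace CircuitDiagram

variable {μ n p : ℕ} {k : Fin p → ℕ} {inward : Fin (2 * n) → Bool}
  {inner : ∀ i, Fin (2 * k i) → Bool}

lemma nonempty_curveEquiv (P : CircuitDiagram μ inward inner) :
    Nonempty ((Σ i, Fin (k i)) ⊕ Fin n ≃ Fin P.q) := by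
  have h1 := Nat.card_congr P.tail
  have h2 := Nat.card_congr P.head
  rw [Nat.card_sum, Nat.card_sigma, Nat.card_fin] at h1 h2
  have h3 := WeldedTangle.card_inward_add inward
  have h4 : ∑ i, Nat.card {x // inner i x = true} + ∑ i, Nat.card {x // inner i x = false} =
      2 * ∑ i, k i := by
    rw [← Finset.sum_add_distrib, Finset.mul_sum]
    exact Finset.sum_congr rfl fun i _ => WeldedTangle.card_inward_add (inner i)
  have h5 : Nat.card ((Σ i, Fin (k i)) ⊕ Fin n) = Nat.card (Fin P.q) := by
    rw [Nat.card_sum, Nat.card_sigma, Nat.card_fin, Nat.card_fin]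
    simp only [Nat.card_fin]
    omega
  exact ⟨(Finite.equivFin _).trans ((finCongr h5).trans (Finite.equivFin _).symm)⟩

lemma innerMap_basis (P : CircuitDiagram μ inward inner) (i : Fin p) (x : Fin (2 * k i)) :
    P.innerMap i (Pi.basisFun (Laurent μ) _ x) = Pi.single (P.innerCurve i x) 1 :=
  Module.Basis.constr_basis _ _ _ _

lemma outerMap_eq (P : CircuitDiagram μ inward inner) :
    P.outerMap = FunOnFinite.linearMap (Laurent μ) (Laurent μ) P.outerCurve := by
  refine (Pi.basisFun (Laurent μ) (Fin (2 * n))).ext fun j => ?_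
  rw [outerMap, Module.Basis.constr_basis]
  simp

lemma innerWedge_tprod (P : CircuitDiagram μ inward inner)
    (u : ∀ i, ⋀[Laurent μ]^(k i) (BoundaryModule μ (k i))) :
    P.innerWedge (PiTensorProduct.tprod (Laurent μ) u) =
      (List.ofFn fun i => ExteriorAlgebra.map (P.innerMap i) (u i).1).prod := by
  rw [innerWedge, PiTensorProduct.lift.tprod]
  rfl

/-- The volume `ω (m (x₁ ⊗ ⋯ ⊗ x_p) ∧ m_∂ y)`, where `x_i` has the coordinates `a i`, as a sum of
determinants of curves. -/
lemma exists_volumeForm_innerWedge_alpha (P : CircuitDiagram μ inward inner)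
    (e : (Σ i, Fin (k i)) ⊕ Fin n ≃ Fin P.q) :
    ∃ ε : ℤˣ, ∀ (a : ∀ i, Set.powersetCard (Fin (2 * k i)) (k i) → Laurent μ)
      (y : Fin n → BoundaryModule μ n),
      volumeForm μ P.q (P.innerWedge (PiTensorProduct.tprod (Laurent μ) fun i =>
          ∑ I, a i I • exteriorPower.ιMulti_family (Laurent μ) (k i)
            (Pi.basisFun (Laurent μ) (Fin (2 * k i))) I) *
        ExteriorAlgebra.map P.outerMap (ExteriorAlgebra.ιMulti (Laurent μ) n y)) =
      ε • ∑ I : ∀ i, Set.powersetCard (Fin (2 * k i)) (k i), (∏ i, a i (I i)) *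
        rowDet e (Sum.elim
          (fun x => Pi.single
            (P.innerCurve x.1 (Set.powersetCard.ofFinEmbEquiv.symm (I x.1) x.2)) 1)
          (fun l => P.outerMap (y l))) := by
  classical
  obtain ⟨ε, hε⟩ := exists_volumeForm_wedge (μ := μ) e
  refine ⟨ε, fun a y => ?_⟩
  rw [MultilinearMap.map_sum, map_sum, Finset.sum_mul, map_sum, Finset.smul_sum]
  refine Finset.sum_congr rfl fun I _ => ?_
  rw [MultilinearMap.map_smul_univ, map_smul, smul_mul_assoc, map_smul, smul_eq_mul,
    ← mul_smul_comm, innerWedge_tprod]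
  congr 1
  simp only [exteriorPower.ιMulti_family_apply_coe, ExteriorAlgebra.ιMulti_family,
    ExteriorAlgebra.map_apply_ιMulti]
  rw [hε]
  congr 3
  funext x
  exact P.innerMap_basis _ _

/-- An edge of the tangle in the disk `D_i`, as an edge of the glued diagram. -/
def glueEdge (P : CircuitDiagram μ inward inner) (T : ∀ i, WeldedTangle μ (inner i))
    (hcolor : P.ColorsMatch T) (i : Fin p) (e : (T i).Edge) : (P.glue T hcolor).Edge :=
  Sum.inl ⟨i, e⟩

/-- A curve, as an edge of the glued diagram. -/
def curveEdge (P : CircuitDiagram μ inward inner) (T : ∀ i, WeldedTangle μ (inner i))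
    (hcolor : P.ColorsMatch T) (c : Fin P.q) : (P.glue T hcolor).Edge :=
  Sum.inr c

/-- The edges of a glued diagram, up to the relations that do not belong to rows of the matrices:
an edge of `T i` becomes its arc if that is internal, and otherwise the curve that meets its arc. -/
def glueCollapse (P : CircuitDiagram μ inward inner) (T : ∀ i, WeldedTangle μ (inner i))
    (hcolor : P.ColorsMatch T) (hT : ∀ i, (T i).IsInterrupted) :
    (P.glue T hcolor).Edge → (Σ i, (T i).InternalArc) ⊕ Fin P.q :=
  Sum.elim (fun e => Sum.map (Sigma.mk e.1) (P.innerCurve e.1)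
    (((T e.1).arcEquiv (hT e.1)).symm ((T e.1).arc e.2))) Sum.inr

/-- The rows of the relations of a glued diagram: those of the upper preimages of the crossings,
those of the inner marked points, and those of the matrices of the tangles; and `n` further rows. -/
def glueRowEquiv (T : ∀ i, WeldedTangle μ (inner i)) (ρ : ∀ i, (T i).RowOrder) (n : ℕ) :
    ((Σ i, (T i).Crossing) ⊕ (Σ i, Fin (2 * k i))) ⊕
        ((Σ i, (T i).InternalArc ⊕ Fin (k i)) ⊕ Fin n) ≃
      Site (Σ i, (T i).Crossing) (GluePoint T) ⊕ Fin n where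
  toFun
    | Sum.inl (Sum.inl c) => Sum.inl (Site.upper c)
    | Sum.inl (Sum.inr x) => Sum.inl (glueMarked T x.1 x.2)
    | Sum.inr (Sum.inl x) => Sum.inl (glueSite T x.1 ((T x.1).rowSite (ρ x.1 x.2)))
    | Sum.inr (Sum.inr l) => Sum.inr l
  invFun
    | Sum.inl (Site.upper c) => Sum.inl (Sum.inl c)
    | Sum.inl (Site.lower c) => Sum.inr (Sum.inl ⟨c.1, (ρ c.1).symm (Sum.inl c.2)⟩)
    | Sum.inl (Site.point (Sum.inl a)) => Sum.inr (Sum.inl ⟨a.1, (ρ a.1).symm (Sum.inr a.2)⟩)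
    | Sum.inl (Site.point (Sum.inr x)) => Sum.inl (Sum.inr x)
    | Sum.inr l => Sum.inr (Sum.inr l)
  left_inv := by
    rintro ((c | x) | (⟨i, s⟩ | l))
    · rfl
    · rfl
    · obtain ⟨r, rfl⟩ := (ρ i).symm.surjective s
      rcases r with c | a <;> simp [glueSite, WeldedTangle.rowSite, Site.map]
    · rfl
  right_inv := by
    rintro ((c | c | (a | x)) | l)
    · rfl
    · simp [glueSite, WeldedTangle.rowSite, Site.map]
    · simp [glueSite, WeldedTangle.rowSite, Site.map]
    · rfl
    · rfl

lemma glue_boundaryEdge (P : CircuitDiagram μ inward inner) (T : ∀ i, WeldedTangle μ (inner i))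
    (hcolor : P.ColorsMatch T) (j : Fin (2 * n)) :
    (P.glue T hcolor).boundaryEdge j = P.curveEdge T hcolor (P.outerCurve j) := by
  by_cases h : inward j = true
  · rw [WeldedTangle.boundaryEdge, outerCurve, dif_pos h, dif_pos h]
    rfl
  · rw [WeldedTangle.boundaryEdge, outerCurve, dif_neg h, dif_neg h]
    rfl

/-- At a marked point of an inner disk, an edge of the tangle meets a curve. -/
lemma glue_marked (P : CircuitDiagram μ inward inner) (T : ∀ i, WeldedTangle μ (inner i))
    (hcolor : P.ColorsMatch T) (i : Fin p) (x : Fin (2 * k i)) :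
    ((P.glue T hcolor).outEdge (glueMarked T i x) = P.glueEdge T hcolor i ((T i).boundaryEdge x) ∧
      (P.glue T hcolor).inEdge (glueMarked T i x) = P.curveEdge T hcolor (P.innerCurve i x)) ∨
    ((P.glue T hcolor).inEdge (glueMarked T i x) = P.glueEdge T hcolor i ((T i).boundaryEdge x) ∧
      (P.glue T hcolor).outEdge (glueMarked T i x) = P.curveEdge T hcolor (P.innerCurve i x)) := by
  by_cases h : inner i x = true
  · left
    rw [WeldedTangle.boundaryEdge, innerCurve, dif_pos h, dif_pos h]
    exact ⟨dif_pos h, dif_neg (by simpa using h)⟩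
  · right
    rw [WeldedTangle.boundaryEdge, innerCurve, dif_neg h, dif_neg h]
    exact ⟨dif_pos (by simpa using h), dif_neg h⟩

lemma glue_siteRow_glueSite (P : CircuitDiagram μ inward inner) (T : ∀ i, WeldedTangle μ (inner i))
    (hcolor : P.ColorsMatch T) (i : Fin p) (s : Site (T i).Crossing (T i).Point) :
    (P.glue T hcolor).siteRow (glueSite T i s) =
      FunOnFinite.linearMap (Laurent μ) (Laurent μ) (P.glueEdge T hcolor i) ((T i).siteRow s) := by
  rcases s with c | c | a
  · rw [WeldedTangle.siteRow, linearMap_pointRow]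
    rfl
  · rw [WeldedTangle.siteRow, linearMap_crossingRow]
    rfl
  · rw [WeldedTangle.siteRow, linearMap_pointRow]
    rfl

/-- Gluing is computed by the map `m`: up to a sign, the alternating form of the glued diagram is
`y ↦ ω (m (α(T₁) ⊗ ⋯ ⊗ α(T_p)) ∧ m_∂ y)`. -/
theorem exists_edgeForm_glue (P : CircuitDiagram μ inward inner)
    (T : ∀ i, WeldedTangle μ (inner i)) (hcolor : P.ColorsMatch T)
    (hT : ∀ i, (T i).IsInterrupted) (ρ : ∀ i, (T i).RowOrder)
    (e : Site (P.glue T hcolor).Crossing (P.glue T hcolor).Point ⊕ Fin n ≃ (P.glue T hcolor).Edge) :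
    ∃ ε : ℤˣ, ∀ y : Fin n → BoundaryModule μ n,
      (P.glue T hcolor).edgeForm e y = ε • volumeForm μ P.q
        (P.innerWedge (PiTensorProduct.tprod (Laurent μ) fun i => (T i).alpha (ρ i)) *
          ExteriorAlgebra.map P.outerMap (ExteriorAlgebra.ιMulti (Laurent μ) n y)) := by
  classical
  have := fun i => Fintype.ofFinite (T i).InternalArc
  obtain ⟨e'⟩ := P.nonempty_curveEquiv
  -- The relations to eliminate: those of the upper preimages and of the inner marked points.
  let r : (Σ i, (T i).Crossing) ⊕ (Σ i, Fin (2 * k i)) → (P.glue T hcolor).Edge → ℤ := Sum.elim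
    (fun c => pointRow ℤ (P.glueEdge T hcolor c.1 ((T c.1).inEdge (Site.upper c.2)))
      (P.glueEdge T hcolor c.1 ((T c.1).outEdge (Site.upper c.2))))
    (fun x => pointRow ℤ ((P.glue T hcolor).inEdge (glueMarked T x.1 x.2))
      ((P.glue T hcolor).outEdge (glueMarked T x.1 x.2)))
  -- An internal arc is represented by any of its edges, and an arc at an inner marked point is
  -- identified with the curve that it meets.
  let s : (Σ i, (T i).InternalArc) ⊕ Fin P.q → (P.glue T hcolor).Edge :=
    Sum.elim (fun a => P.glueEdge T hcolor a.1 (Quot.out a.2.1)) (P.curveEdge T hcolor)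
  have hs : ∀ x, Pi.single x 1 - Pi.single (s (P.glueCollapse T hcolor hT x)) 1 ∈
      Submodule.span ℤ (Set.range r) := by
    rintro (⟨i, x⟩ | c)
    · have hmem : ∀ {e e' : (T i).Edge}, (T i).arc e = (T i).arc e' →
          Pi.single (P.glueEdge T hcolor i e) 1 - Pi.single (P.glueEdge T hcolor i e') 1 ∈
            Submodule.span ℤ (Set.range r) := by
        refine (T i).single_sub_single_mem_of_arc_eq _ _ fun c => ?_
        rw [← pointRow_eq_sub]
        exact Submodule.subset_span ⟨Sum.inl ⟨i, c⟩, rfl⟩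
      obtain ⟨y, hy⟩ := ((T i).arcEquiv (hT i)).surjective ((T i).arc x)
      have h1 : P.glueCollapse T hcolor hT (P.glueEdge T hcolor i x) =
          Sum.map (Sigma.mk i) (P.innerCurve i) y := by
        change Sum.map (Sigma.mk (β := fun i => (T i).InternalArc) i) (P.innerCurve i)
          (((T i).arcEquiv (hT i)).symm ((T i).arc x)) = _
        rw [← hy, Equiv.symm_apply_apply]
      change Pi.single (P.glueEdge T hcolor i x) 1 -
        Pi.single (s (P.glueCollapse T hcolor hT (P.glueEdge T hcolor i x))) 1 ∈ _
      rw [h1]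
      rcases y with a | y
      · refine hmem ?_
        rw [← hy]
        exact (Quot.out_eq a.1).symm
      · rw [← sub_add_sub_cancel _ (Pi.single (P.glueEdge T hcolor i ((T i).boundaryEdge y)) 1)]
        refine Submodule.add_mem _ (hmem hy.symm) ?_
        have h2 : pointRow ℤ ((P.glue T hcolor).inEdge (glueMarked T i y))
            ((P.glue T hcolor).outEdge (glueMarked T i y)) ∈ Submodule.span ℤ (Set.range r) :=
          Submodule.subset_span ⟨Sum.inr ⟨i, y⟩, rfl⟩
        rw [pointRow_eq_sub] at h2
        rcases P.glue_marked T hcolor i y with ⟨h3, h4⟩ | ⟨h3, h4⟩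
        · rw [h3, h4] at h2
          rw [← neg_sub]
          exact Submodule.neg_mem _ h2
        · rw [h3, h4] at h2
          exact h2
    · change Pi.single (P.curveEdge T hcolor c) 1 - Pi.single (P.curveEdge T hcolor c) 1 ∈ _
      rw [sub_self]
      exact Submodule.zero_mem _
  let e₂ : (Σ i, (T i).InternalArc ⊕ Fin (k i)) ⊕ Fin n ≃ (Σ i, (T i).InternalArc) ⊕ Fin P.q :=
    ((Equiv.sigmaSumDistrib _ _).sumCongr (Equiv.refl _)).trans
      ((Equiv.sumAssoc _ _ _).trans ((Equiv.refl _).sumCongr e'))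
  let σ : _ ≃ Site (P.glue T hcolor).Crossing (P.glue T hcolor).Point ⊕ Fin n := glueRowEquiv T ρ n
  obtain ⟨ε₁, h₁⟩ := exists_rowDet_elim (R := Laurent μ) r s (P.glueCollapse T hcolor hT) hs
    σ e e₂
  obtain ⟨ε₂, h₂⟩ := exists_rowDet_cancel (R := Laurent μ) e₂ e'
  obtain ⟨ε₃, h₃⟩ := P.exists_volumeForm_innerWedge_alpha e'
  refine ⟨ε₁ * ε₂ * ε₃, fun y => ?_⟩
  have hrows : (fun b => FunOnFinite.linearMap (Laurent μ) (Laurent μ) (P.glueCollapse T hcolor hT)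
      ((Sum.elim (P.glue T hcolor).siteRow fun l => FunOnFinite.linearMap (Laurent μ) (Laurent μ)
        (P.glue T hcolor).boundaryEdge (y l)) (σ (Sum.inr b)))) =
      Sum.elim (fun x => FunOnFinite.linearMap (Laurent μ) (Laurent μ)
          (Sum.map (Sigma.mk x.1) (P.innerCurve x.1)) ((T x.1).sortedRow (ρ x.1) x.2))
        (fun l => FunOnFinite.linearMap (Laurent μ) (Laurent μ) Sum.inr (P.outerMap (y l))) := by
    funext b
    rcases b with ⟨i, x⟩ | l
    · change FunOnFinite.linearMap (Laurent μ) (Laurent μ) (P.glueCollapse T hcolor hT)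
        ((P.glue T hcolor).siteRow (glueSite T i ((T i).rowSite (ρ i x)))) = _
      rw [glue_siteRow_glueSite, linearMap_linearMap, Sum.elim_inl, (T i).sortedRow_eq (hT i),
        linearMap_linearMap]
      rfl
    · change FunOnFinite.linearMap (Laurent μ) (Laurent μ) (P.glueCollapse T hcolor hT)
        (FunOnFinite.linearMap (Laurent μ) (Laurent μ) (P.glue T hcolor).boundaryEdge (y l)) = _
      rw [Sum.elim_inr, linearMap_linearMap, outerMap_eq, linearMap_linearMap,
        funext (P.glue_boundaryEdge T hcolor)]
      rfl
  rw [WeldedTangle.edgeForm, h₁]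
  · rw [hrows,
      rowDet_laplace e₂ P.innerCurve (fun i => (T i).sortedRow (ρ i)) fun l => P.outerMap (y l)]
    simp only [WeldedTangle.alpha]
    rw [h₃, smul_smul, mul_assoc (ε₁ * ε₂), Int.units_mul_self, mul_one, mul_smul]
    congr 1
    rw [Finset.smul_sum]
    refine Finset.sum_congr rfl fun I _ => ?_
    rw [← mul_smul_comm, ← h₂]
    simp only [WeldedTangle.minor_eq]
    congr 3
    funext x
    rcases x with ⟨i, a | l⟩
    · rfl
    · exact (FunOnFinite.linearMap_piSingle (Laurent μ) (Laurent μ) Sum.inr _ _).symm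
  · rintro (c | x)
    · exact (cast_pointRow _ _).symm
    · exact (cast_pointRow _ _).symm

end CircuitDiagram

/-! ### The trivial circuit diagram and the alternating form of an interrupted diagram -/

namespace WeldedTangle

variable {μ n : ℕ} {inward : Fin (2 * n) → Bool}

/-- The curves of the trivial circuit diagram, indexed by the marked points that they join. -/
def trivialEnds (inward : Fin (2 * n) → Bool) (b : Bool) :
    Fin (2 * n) ≃ {j // inward j = b} ⊕ (Σ _ : Fin 1, {x // inward x = !b}) where
  toFun j := if h : inward j = b then Sum.inl ⟨j, h⟩ else Sum.inr ⟨0, j, Bool.eq_not_of_ne h⟩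
  invFun := Sum.elim Subtype.val fun x => x.2.1
  left_inv j := by
    by_cases h : inward j = b <;> simp [h]
  right_inv x := by
    rcases x with ⟨j, h⟩ | ⟨i, j, h⟩
    · simp [h]
    · obtain rfl := Subsingleton.elim i 0
      simp [h]

/-- The trivial circuit diagram, with one inner disk and with curves joining equally numbered marked
points; the colors are such that `T` fits into the inner disk. -/
def trivialCircuit (T : WeldedTangle μ inward) :
    CircuitDiagram μ (k := fun _ : Fin 1 => n) inward fun _ => inward where
  q := 2 * n
  tail := trivialEnds inward true
  head := trivialEnds inward false
  color j := T.color (T.boundaryEdge j)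

variable (T : WeldedTangle μ inward)

lemma trivialCircuit_outerCurve (j : Fin (2 * n)) : T.trivialCircuit.outerCurve j = j := by
  by_cases h : inward j = true
  · rw [CircuitDiagram.outerCurve, dif_pos h]
    rfl
  · rw [CircuitDiagram.outerCurve, dif_neg h]
    rfl

lemma trivialCircuit_innerCurve (i : Fin 1) (j : Fin (2 * n)) :
    T.trivialCircuit.innerCurve i j = j := by
  by_cases h : inward j = true
  · rw [CircuitDiagram.innerCurve, dif_pos h]
    rfl
  · rw [CircuitDiagram.innerCurve, dif_neg h]
    rfl

lemma trivialCircuit_outerMap : T.trivialCircuit.outerMap = LinearMap.id := by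
  rw [CircuitDiagram.outerMap_eq, funext (T.trivialCircuit_outerCurve)]
  exact FunOnFinite.linearMap_id _ _ _

lemma trivialCircuit_innerMap (i : Fin 1) : T.trivialCircuit.innerMap i = LinearMap.id := by
  refine (Pi.basisFun (Laurent μ) (Fin (2 * n))).ext fun j => ?_
  rw [CircuitDiagram.innerMap_basis, trivialCircuit_innerCurve]
  exact (Pi.basisFun_apply _ _ j).symm

lemma trivialCircuit_colorsMatch : T.trivialCircuit.ColorsMatch fun _ => T := by
  intro i x
  rw [trivialCircuit_innerCurve]
  rfl

/-- Gluing into the trivial circuit diagram only adds auxiliary points next to the boundary. -/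
lemma exists_edgeForm_glue_trivialCircuit
    (e : Site T.Crossing T.Point ⊕ Fin n ≃ T.Edge)
    (e' : Site (T.trivialCircuit.glue _ T.trivialCircuit_colorsMatch).Crossing
      (T.trivialCircuit.glue _ T.trivialCircuit_colorsMatch).Point ⊕ Fin n ≃
        (T.trivialCircuit.glue _ T.trivialCircuit_colorsMatch).Edge) :
    ∃ ε : ℤˣ, ∀ y, (T.trivialCircuit.glue _ T.trivialCircuit_colorsMatch).edgeForm e' y =
      ε • T.edgeForm e y := by
  refine exists_edgeForm_collapse (T := T)
    (T' := T.trivialCircuit.glue _ T.trivialCircuit_colorsMatch)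
    (C := Σ _ : Fin 1, Fin (2 * n)) Sum.inr (fun c => ⟨0, c⟩) (fun a => Sum.inl ⟨0, a⟩) ?_ ?_
    (Sum.elim (fun x => x.2) T.boundaryEdge)
    (T.trivialCircuit.glueEdge _ T.trivialCircuit_colorsMatch 0) ?_ ?_ ?_ (fun _ => rfl) ?_ ?_ e e'
  · refine ⟨fun a b h => ?_, fun ⟨i, c⟩ => ?_⟩
    · have h' : (⟨0, a⟩ : Σ _ : Fin 1, T.Crossing) = ⟨0, b⟩ := h
      simpa using h'
    obtain rfl := Subsingleton.elim i 0
    exact ⟨c, rfl⟩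
  · constructor
    · rintro (x | x) (y | y) h
      · exact congrArg Sum.inl (Sum.inr_injective h)
      · exact absurd h Sum.inr_ne_inl
      · exact absurd h Sum.inl_ne_inr
      · have h' : (⟨0, x⟩ : Σ _ : Fin 1, T.Point) = ⟨0, y⟩ := Sum.inl_injective h
        simpa using h'
    · rintro (⟨i, a⟩ | x)
      · obtain rfl := Subsingleton.elim i 0
        exact ⟨Sum.inr a, rfl⟩
      · exact ⟨Sum.inl x, rfl⟩
  · rintro (⟨i, x⟩ | j)
    · obtain rfl := Subsingleton.elim i 0
      exact Or.inl rfl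
    · refine Or.inr ⟨⟨0, j⟩, ?_⟩
      have h := T.trivialCircuit.glue_marked (fun _ => T) T.trivialCircuit_colorsMatch 0 j
      have hj : T.trivialCircuit.curveEdge _ T.trivialCircuit_colorsMatch
          (T.trivialCircuit.innerCurve 0 j) = Sum.inr j :=
        congrArg Sum.inr (T.trivialCircuit_innerCurve 0 j)
      rcases h with ⟨h₁, h₂⟩ | ⟨h₁, h₂⟩
      · exact Or.inl ⟨h₂.trans hj, h₁⟩
      · exact Or.inr ⟨h₂.trans hj, h₁⟩
  · intro x
    rcases x with c | c | a <;> rfl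
  · intro x
    rcases x with c | c | a <;> rfl
  · rintro (⟨i, x⟩ | j)
    · rfl
    · rfl
  · intro j
    rw [CircuitDiagram.glue_boundaryEdge, trivialCircuit_outerCurve]
    rfl

/-- The invariant `α` of an interrupted diagram is determined up to sign by the alternating form of
the diagram. -/
theorem exists_edgeForm_eq_wedgePairing (hT : T.IsInterrupted) (ρ : T.RowOrder)
    (e : Site T.Crossing T.Point ⊕ Fin n ≃ T.Edge) :
    ∃ ε : ℤˣ, ∀ y, T.edgeForm e y =
      ε • wedgePairing μ n (T.alpha ρ) (exteriorPower.ιMulti (Laurent μ) n y) := by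
  obtain ⟨e'⟩ := (T.trivialCircuit.glue _ T.trivialCircuit_colorsMatch).nonempty_edgeEquiv
  obtain ⟨ε₁, h₁⟩ := T.exists_edgeForm_glue_trivialCircuit e e'
  obtain ⟨ε₂, h₂⟩ := T.trivialCircuit.exists_edgeForm_glue _ T.trivialCircuit_colorsMatch
    (fun _ => hT) (fun _ => ρ) e'
  refine ⟨ε₁ * ε₂, fun y => ?_⟩
  have h := h₁ y
  rw [h₂] at h
  rw [mul_smul, ← one_smul ℤˣ (T.edgeForm e y), ← Int.units_mul_self ε₁, mul_smul, ← h]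
  congr 2
  rw [CircuitDiagram.innerWedge_tprod, trivialCircuit_outerMap, wedgePairing_apply]
  simp only [trivialCircuit_innerMap]
  have hid : ExteriorAlgebra.map (LinearMap.id : BoundaryModule μ n →ₗ[Laurent μ] _) =
      AlgHom.id _ _ := ExteriorAlgebra.map_id
  refine congrArg (volumeForm μ (2 * n)) ?_
  refine congrArg₂ (· * ·) ?_ ?_
  · rw [List.ofFn_succ, List.ofFn_zero, List.prod_singleton]
    exact DFunLike.congr_fun hid _
  · exact DFunLike.congr_fun hid _

end WeldedTangle

end

theorem mainTheorem9 {μ n p : ℕ} {k : Fin p → ℕ} {inward : Fin (2 * n) → Bool}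
    {inner : ∀ i, Fin (2 * k i) → Bool}
    (P : CircuitDiagram μ inward inner)
    (T : ∀ i, WeldedTangle μ (inner i)) (hcolor : P.ColorsMatch T)
    (τ : WeldedTangle μ inward) (hτ : τ.SameTangle (P.glue T hcolor))
    (hT : ∀ i, (T i).IsInterrupted) (hτ' : τ.IsInterrupted)
    (ρ : τ.RowOrder) (ρT : ∀ i, (T i).RowOrder) :
    (∃! γ, P.IsGamma γ) ∧
      ∀ γ, P.IsGamma γ →
        τ.alpha ρ = γ (PiTensorProduct.tprod (Laurent μ) fun i => (T i).alpha (ρT i)) ∨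
        τ.alpha ρ = -γ (PiTensorProduct.tprod (Laurent μ) fun i => (T i).alpha (ρT i)) := by
  refine ⟨P.existsUnique_isGamma, fun γ hγ => ?_⟩
  obtain ⟨T', h, h'⟩ := hτ
  obtain ⟨e⟩ := τ.nonempty_edgeEquiv
  obtain ⟨e'⟩ := T'.nonempty_edgeEquiv
  obtain ⟨e''⟩ := (P.glue T hcolor).nonempty_edgeEquiv
  obtain ⟨ε₁, h₁⟩ := h.exists_edgeForm e e'
  obtain ⟨ε₂, h₂⟩ := h'.exists_edgeForm e'' e'
  obtain ⟨ε₃, h₃⟩ := τ.exists_edgeForm_eq_wedgePairing hτ' ρ e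
  obtain ⟨ε₄, h₄⟩ := P.exists_edgeForm_glue T hcolor hT ρT e''
  set u := γ (PiTensorProduct.tprod (Laurent μ) fun i => (T i).alpha (ρT i)) with hu
  have key : (ε₁ * ε₃) • τ.alpha ρ = (ε₂ * ε₄) • u := by
    refine wedgePairing_bijective.1 (exteriorPower.linearMap_ext (AlternatingMap.ext fun y => ?_))
    have h₅ := hγ (PiTensorProduct.tprod (Laurent μ) fun i => (T i).alpha (ρT i))
      (exteriorPower.ιMulti (Laurent μ) n y)
    have h₆ := (h₁ y).symm.trans (h₂ y)
    rw [h₃, h₄, smul_smul, smul_smul] at h₆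
    simp only [Units.smul_def, map_zsmul, LinearMap.compAlternatingMap_apply,
      LinearMap.smul_apply] at h₆ ⊢
    exact h₆.trans (congrArg _ h₅)
  -- Signs are their own inverses.
  have key' : τ.alpha ρ = ((ε₁ * ε₃) * (ε₂ * ε₄)) • u := by
    rw [mul_smul, ← key, smul_smul, Int.units_mul_self, one_smul]
  rcases Int.units_eq_one_or ((ε₁ * ε₃) * (ε₂ * ε₄)) with h | h
  · left
    rw [key', h, one_smul]
  · right
    rw [key', h, Units.neg_smul, one_smul]
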